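/- \textbf{Conventions.} Let $n\ge 1$. A weight on $\mathbb R^n$ is a non-negative locally integrable function $w$. Averages and suprema take values in $[0,\infty]$, with $0\cdot\infty=0$ and $1/0=\infty$. For a weight $v$ on $\mathbb R$ and $1<p<\infty$ put $$[v]_{A_p}=\sup_I\Big(\frac1{|I|}\int_I v\Big)\Big(\frac1{|I|}\int_I v^{-\frac1{p-1}}\Big)^{p-1},\qquad [v]_{A_1}=\sup_I\Big(\frac1{|I|}\int_I v\Big)\operatorname*{ess\,sup}_I v^{-1},\qquad [v]_{A_\infty}=\sup_I\frac1{v(I)}\int_I M(v\mathbf 1_I),$$ where $I$ runs over the bounded intervals of positive length, $v(I)=\int_I v$ (intervals with $v(I)=0$ contribute $0$ to the last supremum), and $M$ is the non-centered Hardy--Littlewood maximal operator on $\mathbb R$. For a weight $w$ on $\mathbb R^n$, $1\le j\le n$ and $\bar x^j=(x_1,\dots,x_{j-1},x_{j+1},\dots,x_n)\in\mathbb R^{n-1}$ let $w_{\bar x^j}(t)=w(x_1,\dots,x_{j-1},t,x_{j+1},\dots,x_n)$, and for $1\le p\le\infty$ define $$[w]_{A_p^*}=\sup_{1\le j\le n}\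 \operatorname*{ess\,sup}_{\bar x^j\in\mathbb R^{n-1}}\,[w_{\bar x^j}]_{A_p}.$$ The class $A_\infty^*$ consists of the weights $w$ on $\mathbb R^n$ with $[w]_{A_\infty^*}<\infty$. For $1\le p<\infty$ the class $A_p^*$ consists of the weights $w$ on $\mathbb R^n$ for which the supremum defining $[\,\cdot\,]_{A_p}$, taken over all bounded non-degenerate rectangular parallelepipeds in $\mathbb R^n$ with sides parallel to the coordinate axes in place of intervals, is finite. \textbf{Theorem.} There exists a numerical constant $c>0$ such that for every $n\ge1$, every weight $w\in A_\infty^*$ on $\mathbb R^n$ and every real $p\ge e^{c[w]_{A_\infty^*}}$ we have $$w\in A_p^*\qquad\text{and}\qquad [w]_{A_p^*}\le \exp\!\big(\exp\!\big(c\,p\,[w]_{A_\infty^*}\big)\big).$$ -/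

import Mathlib

open MeasureTheory Set
open scoped ENNReal

noncomputable section

namespace StrongWeights

/-- A weight on a space with a topology and a volume: a non-negative, locally integrable function. -/
def IsWeight {α : Type*} [TopologicalSpace α] [MeasureSpace α] (w : α → ℝ) : Prop :=
  (∀ x, 0 ≤ w x) ∧ LocallyIntegrable w volume

/-- The Muckenhoupt expression of `w` on the set `Q`, for `1 ≤ p < ∞`:
`(|Q|⁻¹ ∫_Q w) (|Q|⁻¹ ∫_Q w ^ (-1/(p-1))) ^ (p-1)` if `p > 1`, and
`(|Q|⁻¹ ∫_Q w) (ess sup_Q w⁻¹)` if `p = 1`.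
Values are in `[0, ∞]`, with `0⁻¹ = ∞` and `0 * ∞ = 0`. -/
def apExpr {α : Type*} [MeasureSpace α] (p : ℝ) (w : α → ℝ) (Q : Set α) : ℝ≥0∞ :=
  (⨍⁻ x in Q, ENNReal.ofReal (w x) ∂volume) *
    if p = 1 then essSup (fun x => (ENNReal.ofReal (w x))⁻¹) (volume.restrict Q)
    else (⨍⁻ x in Q, ENNReal.ofReal (w x) ^ (-(1 / (p - 1))) ∂volume) ^ (p - 1)

/-- `[v]_{A_p}` on the real line, `1 ≤ p < ∞`: supremum over all bounded intervals. -/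
def apConst (p : ℝ) (v : ℝ → ℝ) : ℝ≥0∞ :=
  ⨆ (a : ℝ) (b : ℝ) (_ : a < b), apExpr p v (Icc a b)

/-- The non-centered Hardy-Littlewood maximal function on the real line. -/
def maximalFun (f : ℝ → ℝ≥0∞) (x : ℝ) : ℝ≥0∞ :=
  ⨆ (a : ℝ) (b : ℝ) (_ : a < b) (_ : x ∈ Icc a b), ⨍⁻ y in Icc a b, f y ∂volume

/-- The Fujii-Wilson constant `[v]_{A_∞}` on the real line: the supremum over all bounded
intervals `I` of `v(I)⁻¹ ∫_I M(v 1_I)`; intervals with `v(I) = 0` contribute `0`. -/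
def aInftyConst (v : ℝ → ℝ) : ℝ≥0∞ :=
  ⨆ (a : ℝ) (b : ℝ) (_ : a < b),
    (∫⁻ x in Icc a b, maximalFun ((Icc a b).indicator fun y => ENNReal.ofReal (v y)) x) /
      ∫⁻ x in Icc a b, ENNReal.ofReal (v x)

/-- The one-dimensional slice `t ↦ w(x₁, …, x_{j-1}, t, x_{j+1}, …, x_{d+1})`, where `x` collects
the other `d` coordinates. -/
def slice {d : ℕ} (w : (Fin (d + 1) → ℝ) → ℝ) (j : Fin (d + 1)) (x : Fin d → ℝ) : ℝ → ℝ :=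
  fun t => w (j.insertNth t x)

/-- `[w]_{A_p^*}` on `ℝ^(d+1)`, `1 ≤ p < ∞`. -/
def strongApConst {d : ℕ} (p : ℝ) (w : (Fin (d + 1) → ℝ) → ℝ) : ℝ≥0∞ :=
  ⨆ j : Fin (d + 1), essSup (fun x : Fin d → ℝ => apConst p (slice w j x)) volume

/-- `[w]_{A_∞^*}` on `ℝ^(d+1)`. -/
def strongAInftyConst {d : ℕ} (w : (Fin (d + 1) → ℝ) → ℝ) : ℝ≥0∞ :=
  ⨆ j : Fin (d + 1), essSup (fun x : Fin d → ℝ => aInftyConst (slice w j x)) volume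

/-- The `A_p` constant on `ℝⁿ` with respect to axis-parallel rectangular parallelepipeds. -/
def recApConst {n : ℕ} (p : ℝ) (w : (Fin n → ℝ) → ℝ) : ℝ≥0∞ :=
  ⨆ (a : Fin n → ℝ) (b : Fin n → ℝ) (_ : ∀ i, a i < b i), apExpr p w (Icc a b)

/-- The class `A_p^*` on `ℝⁿ`, `1 ≤ p < ∞`. -/
def MemStrongAp {n : ℕ} (p : ℝ) (w : (Fin n → ℝ) → ℝ) : Prop :=
  IsWeight w ∧ recApConst p w < ∞

/-- The class `A_∞^*` on `ℝ^(d+1)`. -/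
def MemStrongAInfty {d : ℕ} (w : (Fin (d + 1) → ℝ) → ℝ) : Prop :=
  IsWeight w ∧ strongAInftyConst w < ∞

end StrongWeights

end

/-!
On the line, put `ν = v dx` and let `N` exceed a multiple of `[v]_{A_∞}`. Riesz's rising sun lemma,
applied on an interval `I` at the heights `2 ^ k ⟨v⟩_I`, `k < N`, gives open sets (shadows) on
whose components `v` has exactly that average and outside of which `v` is below it. They all contain
`{v > 2 ^ N ⟨v⟩_I}` up to a null set, so summing over `k` bounds `N ν({v > 2 ^ N ⟨v⟩_I})` by twice
the integral of the maximal function. Hence a subset of `I` of proportion at most `1 / K`, where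
`K = 2 ^ (N + 2)`, carries at most half of the mass. Iterating this along shadows of the set
`{v < 2 ^ (-k - 1) ⟨v⟩_I}` shows that its proportion is at most `(1 - 1 / K) ^ k`, and summing over
`k` controls the average of `v ^ (-1 / (p - 1))` as soon as `p - 1 ≥ 2 * K`, that is, for `p`
exponentially large in `[v]_{A_∞}`.

In several variables, the `A_p` bound on a set `Q` is equivalent to the inequality
`⟨f⟩_Q ^ p ⟨w⟩_Q ≤ C ⟨f ^ p w⟩_Q` for all `f ≥ 0`, which is linear in `w`. It can therefore be
integrated over one coordinate at a time, and each coordinate of a box costs one factor `C`.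
-/

namespace StrongWeights

open scoped Function NNReal

section RisingSun

variable {U : Set ℝ} {a b c d x : ℝ}

/-- `Ioo c d` is one of the maximal intervals that make up the open set `U` of the line.
Only bounded components are covered. -/
def IsComponentInterval (U : Set ℝ) (c d : ℝ) : Prop :=
  c < d ∧ Ioo c d ⊆ U ∧ c ∉ U ∧ d ∉ U

lemma IsComponentInterval.subset_Icc (h : IsComponentInterval U c d) (hU : U ⊆ Ioo a b) :
    Icc c d ⊆ Icc a b := by
  rw [← closure_Ioo h.1.ne]
  exact closure_minimal ((h.2.1.trans hU).trans Ioo_subset_Icc_self) isClosed_Icc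

lemma exists_isComponentInterval (hU : IsOpen U) (hab : U ⊆ Ioo a b) (hx : x ∈ U) :
    ∃ c d, IsComponentInterval U c d ∧ x ∈ Ioo c d := by
  have ha : a ∉ U := fun h => (hab h).1.false
  have hb : b ∉ U := fun h => (hab h).2.false
  obtain ⟨c, ⟨hcU, hcx : c ≤ x⟩, hc⟩ : ∃ c, IsGreatest (Uᶜ ∩ Iic x) c :=
    ⟨_, (hU.isClosed_compl.inter isClosed_Iic).isGreatest_csSup ⟨a, ha, (hab hx).1.le⟩
      (bddAbove_Iic.mono inter_subset_right)⟩
  obtain ⟨d, ⟨hdU, hxd : x ≤ d⟩, hd⟩ : ∃ d, IsLeast (Uᶜ ∩ Ici x) d :=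
    ⟨_, (hU.isClosed_compl.inter isClosed_Ici).isLeast_csInf ⟨b, hb, (hab hx).2.le⟩
      (bddBelow_Ici.mono inter_subset_right)⟩
  have hcx' : c < x := hcx.lt_of_ne fun h => hcU (h ▸ hx)
  have hxd' : x < d := hxd.lt_of_ne fun h => hdU (h ▸ hx)
  refine ⟨c, d, ⟨hcx'.trans hxd', fun y hy => ?_, hcU, hdU⟩, hcx', hxd'⟩
  by_contra hyU
  rcases le_total y x with hyx | hxy
  · exact hy.1.not_ge (hc ⟨hyU, hyx⟩)
  · exact hy.2.not_ge (hd ⟨hyU, hxy⟩)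

lemma IsComponentInterval.eq_of_mem {c' d' : ℝ} (h : IsComponentInterval U c d)
    (h' : IsComponentInterval U c' d') (hx : x ∈ Ioo c d) (hx' : x ∈ Ioo c' d') :
    c = c' ∧ d = d' := by
  have left {c d c' d' : ℝ} (h : IsComponentInterval U c d) (h' : IsComponentInterval U c' d')
      (hx : x ∈ Ioo c d) (hx' : x ∈ Ioo c' d') : c' ≤ c ∧ d ≤ d' :=
    ⟨not_lt.1 fun hlt => h'.2.2.1 (h.2.1 ⟨hlt, hx'.1.trans hx.2⟩),
      not_lt.1 fun hlt => h'.2.2.2 (h.2.1 ⟨hx.1.trans hx'.2, hlt⟩)⟩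
  have h₁ := left h h' hx hx'
  have h₂ := left h' h hx' hx
  exact ⟨h₂.1.antisymm h₁.1, h₁.2.antisymm h₂.2⟩

lemma measure_le_of_isComponentInterval {μ ν : Measure ℝ} (hU : IsOpen U) (hab : U ⊆ Ioo a b)
    (h : ∀ c d, IsComponentInterval U c d → μ (Ioo c d) ≤ ν (Ioo c d)) : μ U ≤ ν U := by
  let J (i : {q : ℝ × ℝ // IsComponentInterval U q.1 q.2}) : Set ℝ := Ioo i.1.1 i.1.2
  have hUJ : U = ⋃ i, J i := by
    refine Subset.antisymm (fun x hx => ?_) (iUnion_subset fun i => i.2.2.1)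
    obtain ⟨c, d, hcd, hxcd⟩ := exists_isComponentInterval hU hab hx
    exact mem_iUnion.2 ⟨⟨(c, d), hcd⟩, hxcd⟩
  have hdisj : Pairwise (Disjoint on J) := fun i j hij => by
    refine Set.disjoint_left.2 fun x hxi hxj => hij (Subtype.ext ?_)
    obtain ⟨hc, hd⟩ := i.2.eq_of_mem j.2 hxi hxj
    exact Prod.ext hc hd
  have := hdisj.countable_of_isOpen_disjoint (fun _ => isOpen_Ioo)
    fun i => nonempty_Ioo.2 i.2.1
  rw [hUJ, measure_iUnion hdisj fun _ => measurableSet_Ioo,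
    measure_iUnion hdisj fun _ => measurableSet_Ioo]
  exact ENNReal.tsum_le_tsum fun i => h _ _ i.2

variable {f : ℝ → ℝ}

/-- The points of `(a, b)` that lie in the shade when the graph of `f` is lit horizontally from the
right. -/
def risingSet (f : ℝ → ℝ) (a b : ℝ) : Set ℝ :=
  {x ∈ Ioo a b | ∃ y ∈ Ioc x b, f x < f y}

lemma isOpen_risingSet (hf : Continuous f) : IsOpen (risingSet f a b) := by
  have : risingSet f a b = Ioo a b ∩ ⋃ y ∈ Iic b, Iio y ∩ f ⁻¹' Iio (f y) := by
    ext x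
    simp only [risingSet, mem_ofPred_eq, mem_inter_iff, mem_iUnion, mem_Iic, mem_Iio, mem_preimage,
      mem_Ioc, exists_prop]
    grind
  rw [this]
  exact isOpen_Ioo.inter
    (isOpen_biUnion fun y _ => isOpen_Iio.inter (isOpen_Iio.preimage hf))

lemma le_of_mem_component_risingSet (hf : Continuous f)
    (h : IsComponentInterval (risingSet f a b) c d) (hx : x ∈ Ioo c d) : f x ≤ f d := by
  obtain ⟨z, ⟨⟨hxz, hzd⟩, hfxz : f x ≤ f z⟩, hz⟩ :
      ∃ z, IsGreatest (Icc x d ∩ {z | f x ≤ f z}) z :=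
    (isCompact_Icc.inter_right (isClosed_le continuous_const hf)).exists_isGreatest
      ⟨x, ⟨le_rfl, hx.2.le⟩, le_refl (f x)⟩
  rcases hzd.eq_or_lt with rfl | hzd
  · exact hfxz
  by_contra! hdx
  obtain ⟨⟨haz, -⟩, y, ⟨hzy, hyb⟩, hfzy⟩ := h.2.1 ⟨hx.1.trans_le hxz, hzd⟩
  rcases le_or_gt y d with hyd | hdy
  · exact hzy.not_ge (hz ⟨⟨hxz.trans hzy.le, hyd⟩, hfxz.trans hfzy.le⟩)
  · exact h.2.2.2 ⟨⟨haz.trans hzd, hdy.trans_le hyb⟩, y, ⟨hdy, hyb⟩,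
      (hdx.trans_le hfxz).trans hfzy⟩

lemma eq_of_component_risingSet (hf : Continuous f) (hmax : ∀ x ∈ Icc a b, f x ≤ f a)
    (h : IsComponentInterval (risingSet f a b) c d) : f c = f d := by
  have hsub : Icc c d ⊆ Icc a b := h.subset_Icc fun _ hx => hx.1
  have hd : d ∈ Icc a b := hsub ⟨h.1.le, le_rfl⟩
  have hcd : Icc c d ⊆ {x | f x ≤ f d} := by
    rw [← closure_Ioo h.1.ne]
    exact closure_minimal (fun x hx => le_of_mem_component_risingSet hf h hx)
      (isClosed_le hf continuous_const)
  refine le_antisymm (hcd ⟨le_rfl, h.1.le⟩) (not_lt.1 fun hlt => ?_)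
  rcases (hsub ⟨le_rfl, h.1.le⟩).1.eq_or_lt with rfl | hac
  · exact (hmax d hd).not_gt hlt
  · exact h.2.2.1 ⟨⟨hac, h.1.trans_le hd.2⟩, d, ⟨h.1, hd.2⟩, hlt⟩

theorem rising_sun (hf : Continuous f) (hab : a < b) (hfab : f b ≤ f a) :
    ∃ Ω : Set ℝ, IsOpen Ω ∧ Ω ⊆ Ioo a b ∧ (∀ x ∈ Ioo a b \ Ω, ∀ y ∈ Ioc x b, f y ≤ f x) ∧
      ∀ c d, IsComponentInterval Ω c d → f c = f d := by
  obtain ⟨e, ⟨⟨hae, heb⟩, hfae : f a ≤ f e⟩, he⟩ : ∃ e, IsGreatest (Icc a b ∩ {x | f a ≤ f x}) e :=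
    (isCompact_Icc.inter_right (isClosed_le continuous_const hf)).exists_isGreatest
      ⟨a, ⟨le_rfl, hab.le⟩, le_refl (f a)⟩
  have hlt (y) (hey : e < y) (hyb : y ≤ b) : f y < f a :=
    not_le.1 fun h => hey.not_ge (he ⟨⟨hae.trans hey.le, hyb⟩, h⟩)
  have hfea : f e = f a := by
    refine hfae.antisymm' (not_lt.1 fun hlt' => ?_)
    obtain ⟨y, ⟨hey, hyb⟩, hy⟩ := intermediate_value_Icc' heb hf.continuousOn ⟨hfab, hlt'.le⟩
    exact hlt'.ne (hy ▸ congrArg f (le_antisymm (he ⟨⟨hae.trans hey, hyb⟩, hy.ge⟩) hey))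
  have heΩ : e ∉ Ioo a e ∪ risingSet f e b := fun h => h.elim (·.2.false) (·.1.1.false)
  refine ⟨Ioo a e ∪ risingSet f e b, isOpen_Ioo.union (isOpen_risingSet hf),
    union_subset (Ioo_subset_Ioo_right heb) fun x hx => ⟨hae.trans_lt hx.1.1, hx.1.2⟩, ?_, ?_⟩
  · rintro x ⟨hx, hxΩ⟩ y hy
    rw [mem_union, not_or] at hxΩ
    rcases (not_lt.1 fun h => hxΩ.1 ⟨hx.1, h⟩ : e ≤ x).eq_or_lt with rfl | hex
    · exact hfea ▸ (hlt y hy.1 hy.2).le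
    · exact not_lt.1 fun h => hxΩ.2 ⟨⟨hex, hx.2⟩, y, hy, h⟩
  · rintro c d ⟨hcd, hsub, hc, hd⟩
    rcases le_or_gt d e with hde | hed
    · have hIoo : Ioo c d ⊆ Ioo a e := fun x hx =>
        (hsub hx).resolve_right fun h => h.1.1.not_gt (hx.2.trans_le hde)
      obtain ⟨hac, -⟩ := (Ioo_subset_Ioo_iff hcd).1 hIoo
      obtain rfl : d = e :=
        hde.antisymm (not_lt.1 fun h => hd (Or.inl ⟨hac.trans_lt hcd, h⟩))
      obtain rfl : a = c := hac.antisymm (not_lt.1 fun h => hc (Or.inl ⟨h, hcd⟩))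
      exact hfea.symm
    · have hec : e ≤ c := not_lt.1 fun h => heΩ (hsub ⟨h, hed⟩)
      refine eq_of_component_risingSet hf (fun x hx => ?_) ⟨hcd, fun x hx => ?_,
        fun h => hc (Or.inr h), fun h => hd (Or.inr h)⟩
      · rcases hx.1.eq_or_lt with rfl | hex
        exacts [le_rfl, hfea ▸ (hlt x hex hx.2).le]
      · exact (hsub hx).resolve_left fun h => h.2.not_ge (hec.trans hx.1.le)

end RisingSun

section Shadow

variable {μ ν : Measure ℝ} {Ω : Set ℝ} {a b : ℝ}

/-- `Ω` is a shadow of `ν` relative to `μ` in `(a, b)`: the open set provided by the rising sun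
lemma for the difference of the distribution functions of `ν` and `μ`. -/
structure IsShadow (ν μ : Measure ℝ) (a b : ℝ) (Ω : Set ℝ) : Prop where
  isOpen : IsOpen Ω
  subset : Ω ⊆ Ioo a b
  measure_Ioc_le : ∀ x ∈ Ioo a b \ Ω, ∀ y ∈ Ioc x b, ν (Ioc x y) ≤ μ (Ioc x y)
  measure_component : ∀ c d, IsComponentInterval Ω c d → ν (Ioo c d) = μ (Ioo c d)

instance nullSingletonClass_smul {α : Type*} [MeasurableSpace α] {μ : Measure α}
    [NullSingletonClass μ] (t : ℝ≥0) : NullSingletonClass (t • μ) :=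
  ⟨fun x => by simp⟩

theorem exists_isShadow [IsLocallyFiniteMeasure ν] [IsLocallyFiniteMeasure μ]
    [NullSingletonClass ν] [NullSingletonClass μ] (hab : a < b) (h : ν (Ioo a b) ≤ μ (Ioo a b)) :
    ∃ Ω, IsShadow ν μ a b Ω := by
  let f (x : ℝ) : ℝ := (∫ _ in a..x, (1 : ℝ) ∂ν) - ∫ _ in a..x, (1 : ℝ) ∂μ
  have hf : Continuous f :=
    (intervalIntegral.continuous_primitive (fun _ _ => intervalIntegrable_const) a).sub
      (intervalIntegral.continuous_primitive (fun _ _ => intervalIntegrable_const) a)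
  have hf_sub (x y : ℝ) (hxy : x ≤ y) : f y - f x = ν.real (Ioc x y) - μ.real (Ioc x y) := by
    simp only [f]
    rw [sub_sub_sub_comm, intervalIntegral.integral_interval_sub_left intervalIntegrable_const
      intervalIntegrable_const, intervalIntegral.integral_interval_sub_left
      intervalIntegrable_const intervalIntegrable_const]
    simp [intervalIntegral.integral_of_le hxy]
  have hle (x y : ℝ) (hxy : x ≤ y) : f y ≤ f x ↔ ν (Ioc x y) ≤ μ (Ioc x y) := by
    rw [← sub_nonpos, hf_sub x y hxy, sub_nonpos]
    exact ENNReal.toReal_le_toReal measure_Ioc_lt_top.ne measure_Ioc_lt_top.ne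
  have heq (x y : ℝ) (hxy : x ≤ y) : f x = f y ↔ ν (Ioc x y) = μ (Ioc x y) := by
    rw [eq_comm, ← sub_eq_zero, hf_sub x y hxy, sub_eq_zero]
    exact ENNReal.toReal_eq_toReal_iff' measure_Ioc_lt_top.ne measure_Ioc_lt_top.ne
  rw [measure_congr Ioo_ae_eq_Ioc, measure_congr Ioo_ae_eq_Ioc, ← hle a b hab.le] at h
  obtain ⟨Ω, hΩ, hsub, hout, hcomp⟩ := rising_sun hf hab h
  refine ⟨Ω, hΩ, hsub, fun x hx y hy => (hle x y hy.1.le).1 (hout x hx y hy), fun c d hcd => ?_⟩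
  rw [measure_congr Ioo_ae_eq_Ioc, measure_congr Ioo_ae_eq_Ioc]
  exact (heq c d hcd.1.le).1 (hcomp c d hcd)

lemma IsShadow.measure_eq (h : IsShadow ν μ a b Ω) : ν Ω = μ Ω :=
  le_antisymm
    (measure_le_of_isComponentInterval h.isOpen h.subset fun c d hcd =>
      (h.measure_component c d hcd).le)
    (measure_le_of_isComponentInterval h.isOpen h.subset fun c d hcd =>
      (h.measure_component c d hcd).ge)

lemma IsShadow.ae_le {u : ℝ → ℝ≥0∞} (hu : Measurable u) {t : ℝ≥0}
    [IsLocallyFiniteMeasure (volume.withDensity u)]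
    (h : IsShadow (volume.withDensity u) (t • volume) a b Ω) :
    ∀ᵐ x, x ∈ Ioo a b \ Ω → u x ≤ t := by
  filter_upwards [(IsUnifLocDoublingMeasure.vitaliFamily (volume : Measure ℝ) 1).ae_tendsto_rnDeriv
    (volume.withDensity u), Measure.rnDeriv_withDensity volume hu] with x hx hux hxΩ
  have hlim := hx.comp (Real.tendsto_Icc_vitaliFamily_right x)
  rw [hux] at hlim
  refine le_of_tendsto hlim ?_
  filter_upwards [Ioc_mem_nhdsGT hxΩ.1.2] with y hy
  refine ENNReal.div_le_of_le_mul ?_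
  rw [measure_congr Ioc_ae_eq_Icc.symm, measure_congr Ioc_ae_eq_Icc.symm]
  exact h.measure_Ioc_le x hxΩ y hy

end Shadow

section HalfMass

variable {u : ℝ → ℝ≥0∞} {ν : Measure ℝ} {a b : ℝ} {q : ℝ≥0}

lemma withDensity_le_mul_of_forall_mem_le {α : Type*} [MeasurableSpace α] {μ : Measure α}
    {u : α → ℝ≥0∞} {c : ℝ≥0∞} {s : Set α} (hs : MeasurableSet s) (h : ∀ x ∈ s, u x ≤ c) :
    μ.withDensity u s ≤ c * μ s := by
  rw [withDensity_apply _ hs, ← setLIntegral_const]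
  exact setLIntegral_mono measurable_const h

lemma laverage_le_maximalFun_indicator {c d x : ℝ} (hcd : c < d) (hsub : Icc c d ⊆ Icc a b)
    (hx : x ∈ Icc c d) :
    ⨍⁻ y in Icc c d, u y ∂volume ≤ maximalFun ((Icc a b).indicator u) x := by
  rw [← setLAverage_congr_fun measurableSet_Icc fun y hy => indicator_of_mem (hsub hy) u]
  exact le_iSup_of_le c <| le_iSup_of_le d <| le_iSup_of_le hcd <| le_iSup_of_le hx le_rfl

lemma IsShadow.le_maximalFun {Ω : Set ℝ} {t : ℝ≥0} {x : ℝ}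
    (h : IsShadow (volume.withDensity u) (t • volume) a b Ω) (hx : x ∈ Ω) :
    (t : ℝ≥0∞) ≤ maximalFun ((Icc a b).indicator u) x := by
  obtain ⟨c, d, hcd, hxcd⟩ := exists_isComponentInterval h.isOpen h.subset hx
  refine le_trans (le_of_eq ?_) (laverage_le_maximalFun_indicator hcd.1
    (hcd.subset_Icc h.subset) (Ioo_subset_Icc_self hxcd))
  have hν := h.measure_component c d hcd
  rw [withDensity_apply _ measurableSet_Ioo, setLIntegral_congr Ioo_ae_eq_Icc,
    measure_congr Ioo_ae_eq_Icc, Measure.smul_apply] at hν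
  rw [setLAverage_eq, hν, ENNReal.smul_def, smul_eq_mul, ENNReal.mul_div_cancel_right
    (by simpa using hcd.1) (by simp)]

lemma sum_indicator_two_pow_le {α : Type*} {Ω : ℕ → Set α} {L m : ℝ≥0∞} {x : α}
    (h : ∀ k, x ∈ Ω k → 2 ^ k * L ≤ m) (N : ℕ) :
    ∑ k ∈ Finset.range N, (Ω k).indicator (fun _ => 2 ^ k * L) x ≤ 2 * m := by
  suffices H : ∑ k ∈ Finset.range N, (Ω k).indicator (fun _ => 2 ^ k * L) x ≤
      min (2 * m) (2 ^ N * L) from H.trans (min_le_left _ _)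
  induction N with
  | zero => simp
  | succ N ih =>
    rw [Finset.sum_range_succ]
    rw [le_min_iff] at ih ⊢
    have hpow : (2 : ℝ≥0∞) ^ (N + 1) * L = 2 ^ N * L + 2 ^ N * L := by ring
    by_cases hx : x ∈ Ω N
    · rw [indicator_of_mem hx, hpow, two_mul m]
      exact ⟨add_le_add (ih.2.trans (h N hx)) (h N hx), by gcongr; exact ih.2⟩
    · rw [indicator_of_notMem hx, add_zero, hpow]
      exact ⟨ih.1, ih.2.trans le_self_add⟩

lemma IsShadow.withDensity_lt_le (hu : Measurable u)
    [IsLocallyFiniteMeasure (volume.withDensity u)] {Ω : Set ℝ} {t : ℝ≥0}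
    (h : IsShadow (volume.withDensity u) (t • volume) a b Ω) :
    volume.withDensity u (Ioo a b ∩ {x | t < u x}) ≤ t * volume Ω := by
  calc volume.withDensity u (Ioo a b ∩ {x | t < u x}) ≤ volume.withDensity u Ω := by
        refine measure_mono_ae ?_
        filter_upwards [(withDensity_absolutelyContinuous volume u).ae_le (h.ae_le hu)]
          with x hx hxu
        by_contra hxΩ
        exact (hx ⟨hxu.1, hxΩ⟩).not_gt hxu.2
    _ = t * volume Ω := by
        rw [h.measure_eq, Measure.smul_apply, ENNReal.smul_def, smul_eq_mul]

lemma nat_mul_measure_lt_le (hu : Measurable u) [IsLocallyFiniteMeasure (volume.withDensity u)]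
    (hab : a < b) {L : ℝ≥0} (hL : volume.withDensity u (Ioo a b) = L * volume (Ioo a b)) (N : ℕ) :
    N * volume.withDensity u (Ioo a b ∩ {x | 2 ^ N * L < u x}) ≤
      2 * ∫⁻ x in Icc a b, maximalFun ((Icc a b).indicator u) x := by
  -- The superlevel set lies in the shadows at all the levels `2 ^ k * L` with `k < N`, while the
  -- levels of the shadows through one point form a geometric sum below the maximal function there.
  have hex (k : ℕ) : ∃ Ω, IsShadow (volume.withDensity u) ((2 ^ k * L) • volume) a b Ω := by
    refine exists_isShadow hab ?_
    rw [hL, Measure.smul_apply, ENNReal.smul_def, smul_eq_mul]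
    gcongr
    exact le_mul_of_one_le_left' (one_le_pow₀ one_le_two)
  choose Ω hΩ using hex
  have hmeas (k : ℕ) : MeasurableSet (Ω k) := (hΩ k).isOpen.measurableSet
  have hlevel (k : ℕ) (hk : k < N) :
      volume.withDensity u (Ioo a b ∩ {x | 2 ^ N * L < u x}) ≤ 2 ^ k * L * volume (Ω k) := by
    have hkN : (2 : ℝ≥0∞) ^ k * L ≤ 2 ^ N * L := by
      gcongr
      exact one_le_two
    refine (measure_mono (inter_subset_inter_right _ fun x hx => ?_)).trans
      (by simpa using (hΩ k).withDensity_lt_le hu)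
    exact hkN.trans_lt hx
  calc (N : ℝ≥0∞) * volume.withDensity u (Ioo a b ∩ {x | 2 ^ N * L < u x})
      = ∑ _k ∈ Finset.range N, volume.withDensity u (Ioo a b ∩ {x | 2 ^ N * L < u x}) := by simp
    _ ≤ ∑ k ∈ Finset.range N, 2 ^ k * L * volume (Ω k) :=
      Finset.sum_le_sum fun k hk => hlevel k (Finset.mem_range.1 hk)
    _ = ∫⁻ x in Icc a b, ∑ k ∈ Finset.range N, (Ω k).indicator (fun _ => 2 ^ k * (L : ℝ≥0∞)) x := by
      rw [lintegral_finsetSum _ fun k _ => measurable_const.indicator (hmeas k)]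
      refine Finset.sum_congr rfl fun k _ => ?_
      rw [lintegral_indicator_const (hmeas k), Measure.restrict_apply (hmeas k),
        inter_eq_left.2 ((hΩ k).subset.trans Ioo_subset_Icc_self)]
    _ ≤ ∫⁻ x in Icc a b, 2 * maximalFun ((Icc a b).indicator u) x := by
      gcongr with x
      exact sum_indicator_two_pow_le (fun k hk => by simpa using (hΩ k).le_maximalFun hk) N
    _ = 2 * ∫⁻ x in Icc a b, maximalFun ((Icc a b).indicator u) x :=
      lintegral_const_mul' _ _ (by simp)

theorem two_mul_measure_le_of_small (hu : Measurable u)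
    [IsLocallyFiniteMeasure (volume.withDensity u)] (hab : a < b) {N : ℕ} (hN : N ≠ 0)
    (hM : 8 * ∫⁻ x in Icc a b, maximalFun ((Icc a b).indicator u) x ≤
      N * volume.withDensity u (Ioo a b))
    {E : Set ℝ} (hE : MeasurableSet E) (hEI : E ⊆ Ioo a b)
    (hsmall : 2 ^ (N + 2) * volume E ≤ volume (Ioo a b)) :
    2 * volume.withDensity u E ≤ volume.withDensity u (Ioo a b) := by
  set ν := volume.withDensity u
  obtain ⟨L, hL⟩ : ∃ L : ℝ≥0, ν (Ioo a b) = L * volume (Ioo a b) := by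
    refine ⟨(ν (Ioo a b) / volume (Ioo a b)).toNNReal, ?_⟩
    have hvol : volume (Ioo a b) ≠ 0 := by simpa using hab
    rw [ENNReal.coe_toNNReal (ENNReal.div_ne_top measure_Ioo_lt_top.ne hvol),
      ENNReal.div_mul_cancel hvol measure_Ioo_lt_top.ne]
  set G := {x | 2 ^ N * (L : ℝ≥0∞) < u x}
  have hG : MeasurableSet G := measurableSet_lt measurable_const hu
  have hlarge : 4 * ν (Ioo a b ∩ G) ≤ ν (Ioo a b) := by
    rw [← ENNReal.mul_le_mul_iff_right (Nat.cast_ne_zero.2 hN) (ENNReal.natCast_ne_top N)]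
    calc (N : ℝ≥0∞) * (4 * ν (Ioo a b ∩ G)) = 4 * (N * ν (Ioo a b ∩ G)) := by ring
      _ ≤ 4 * (2 * ∫⁻ x in Icc a b, maximalFun ((Icc a b).indicator u) x) := by
        gcongr 4 * ?_
        exact nat_mul_measure_lt_le hu hab hL N
      _ = 8 * ∫⁻ x in Icc a b, maximalFun ((Icc a b).indicator u) x := by ring
      _ ≤ N * ν (Ioo a b) := hM
  have hmoderate : 4 * ν (E \ G) ≤ ν (Ioo a b) := by
    calc 4 * ν (E \ G) ≤ 4 * (2 ^ N * L * volume E) := by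
          gcongr 4 * ?_
          exact (withDensity_le_mul_of_forall_mem_le (hE.diff hG) fun x hx => not_lt.1 hx.2).trans
            (by gcongr; exact sdiff_subset)
      _ = L * (2 ^ (N + 2) * volume E) := by ring
      _ ≤ L * volume (Ioo a b) := by gcongr
      _ = ν (Ioo a b) := hL.symm
  have hsplit : ν E ≤ ν (Ioo a b ∩ G) + ν (E \ G) := by
    rw [← measure_inter_add_sdiff E hG]
    gcongr
  refine (ENNReal.mul_le_mul_iff_right two_ne_zero ENNReal.ofNat_ne_top).1 ?_
  calc 2 * (2 * ν E) ≤ 2 * (2 * (ν (Ioo a b ∩ G) + ν (E \ G))) := by gcongr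
    _ = 4 * ν (Ioo a b ∩ G) + 4 * ν (E \ G) := by ring
    _ ≤ ν (Ioo a b) + ν (Ioo a b) := by gcongr
    _ = 2 * ν (Ioo a b) := (two_mul _).symm

/-- Every subset of an interval of Lebesgue proportion at least `q` carries at least half of the
`ν`-mass of the interval. This is the quantitative absolute continuity that the `A_∞` condition
provides. -/
def HalfMass (ν : Measure ℝ) (q : ℝ≥0) : Prop :=
  ∀ a b, a < b → ∀ E, MeasurableSet E → q * volume (Ioo a b) ≤ volume (Ioo a b ∩ E) →
    ν (Ioo a b) ≤ 2 * ν (Ioo a b ∩ E)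

theorem halfMass_of_maximalFun_le (hu : Measurable u)
    [IsLocallyFiniteMeasure (volume.withDensity u)] {N : ℕ} (hN : N ≠ 0)
    (hM : ∀ a b, a < b → 8 * ∫⁻ x in Icc a b, maximalFun ((Icc a b).indicator u) x ≤
      N * ∫⁻ x in Icc a b, u x) :
    HalfMass (volume.withDensity u) (1 - (2 ^ (N + 2))⁻¹) := by
  intro a b hab E hE hqE
  set ν := volume.withDensity u
  set K : ℝ≥0 := 2 ^ (N + 2) with hK
  have hK0 : K ≠ 0 := by positivity
  have hsmall : K * volume (Ioo a b \ E) ≤ volume (Ioo a b) := by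
    have hq : (1 - K⁻¹) + K⁻¹ = 1 := tsub_add_cancel_of_le (inv_le_one_of_one_le₀ (by
      rw [hK]; exact one_le_pow₀ one_le_two))
    have : volume (Ioo a b \ E) ≤ (K⁻¹ : ℝ≥0) * volume (Ioo a b) := by
      refine (ENNReal.add_le_add_iff_left (a := (1 - K⁻¹ : ℝ≥0) * volume (Ioo a b))
        (ENNReal.mul_ne_top ENNReal.coe_ne_top measure_Ioo_lt_top.ne)).1 ?_
      calc ((1 - K⁻¹ : ℝ≥0) : ℝ≥0∞) * volume (Ioo a b) + volume (Ioo a b \ E)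
          ≤ volume (Ioo a b ∩ E) + volume (Ioo a b \ E) := by gcongr
        _ = volume (Ioo a b) := measure_inter_add_sdiff _ hE
        _ = _ := by rw [← add_mul, ← ENNReal.coe_add, hq, ENNReal.coe_one, one_mul]
    calc (K : ℝ≥0∞) * volume (Ioo a b \ E)
        ≤ K * ((K⁻¹ : ℝ≥0) * volume (Ioo a b)) := by gcongr
      _ = volume (Ioo a b) := by
        rw [← mul_assoc, ← ENNReal.coe_mul, mul_inv_cancel₀ hK0, ENNReal.coe_one, one_mul]
  have hdiff : 2 * ν (Ioo a b \ E) ≤ ν (Ioo a b) := by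
    refine two_mul_measure_le_of_small hu hab hN ?_ (measurableSet_Ioo.diff hE) sdiff_subset
      (by simpa [hK] using hsmall)
    rw [withDensity_apply _ measurableSet_Ioo, setLIntegral_congr Ioo_ae_eq_Icc]
    exact hM a b hab
  refine (ENNReal.add_le_add_iff_left (a := ν (Ioo a b)) measure_Ioo_lt_top.ne).1 ?_
  calc ν (Ioo a b) + ν (Ioo a b) = 2 * ν (Ioo a b ∩ E) + 2 * ν (Ioo a b \ E) := by
        rw [← mul_add, measure_inter_add_sdiff _ hE, two_mul]
    _ ≤ 2 * ν (Ioo a b ∩ E) + ν (Ioo a b) := by gcongr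
    _ = _ := add_comm _ _

lemma IsShadow.volume_le_mul {E Ω : Set ℝ} (h : IsShadow (volume.restrict E) (q • volume) a b Ω)
    (hq : q < 1) (hE : MeasurableSet E) (hEI : E ⊆ Ioo a b) : volume E ≤ q * volume Ω := by
  have hdens : volume.withDensity (E.indicator 1) = volume.restrict E :=
    withDensity_indicator_one hE
  have : IsLocallyFiniteMeasure (volume.withDensity (E.indicator (1 : ℝ → ℝ≥0∞))) :=
    hdens ▸ inferInstance
  have hle := IsShadow.ae_le (measurable_one.indicator hE) (hdens.symm ▸ h)
  calc volume E ≤ volume (Ω ∩ E) := by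
        refine measure_mono_ae ?_
        filter_upwards [hle] with x hx hxE
        refine ⟨by_contra fun hxΩ => ?_, hxE⟩
        have := hx ⟨hEI hxE, hxΩ⟩
        rw [indicator_of_mem hxE, Pi.one_apply, ENNReal.one_le_coe_iff] at this
        exact this.not_gt hq
    _ = volume.restrict E Ω := (Measure.restrict_apply h.isOpen.measurableSet).symm
    _ = q * volume Ω := h.measure_eq

lemma HalfMass.measure_shadow_le {E Ω : Set ℝ} (h : HalfMass ν q) (hE : MeasurableSet E)
    (hΩ : IsShadow (volume.restrict E) (q • volume) a b Ω) : ν Ω ≤ 2 * ν E := by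
  calc ν Ω ≤ ((2 : ℝ≥0) • ν.restrict E) Ω := by
        refine measure_le_of_isComponentInterval hΩ.isOpen hΩ.subset fun c d hcd => ?_
        have hcomp := hΩ.measure_component c d hcd
        rw [Measure.restrict_apply measurableSet_Ioo] at hcomp
        have := h c d hcd.1 E hE hcomp.ge
        rwa [Measure.smul_apply, Measure.restrict_apply measurableSet_Ioo]
    _ ≤ 2 * ν E := by
        rw [Measure.smul_apply, ENNReal.smul_def, smul_eq_mul, ENNReal.coe_ofNat,
          Measure.restrict_apply hΩ.isOpen.measurableSet]
        gcongr
        exact inter_subset_right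

theorem HalfMass.volume_le_or_measure_le (h : HalfMass ν q) (hq : q < 1) (hab : a < b) (k : ℕ) :
    ∀ E, MeasurableSet E → E ⊆ Ioo a b →
      volume E ≤ q ^ k * volume (Ioo a b) ∨ ν (Ioo a b) ≤ 2 ^ k * ν E := by
  induction k with
  | zero => exact fun E _ hE => Or.inl (by simpa using measure_mono (μ := volume) hE)
  | succ k ih =>
    intro E hE hEI
    rcases le_total (q * volume (Ioo a b)) (volume E) with hlarge | hsmall
    · have hhalf := h a b hab E hE (by rwa [inter_eq_right.2 hEI])
      rw [inter_eq_right.2 hEI] at hhalf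
      refine Or.inr (hhalf.trans ?_)
      gcongr
      exact le_self_pow₀ one_le_two k.succ_ne_zero
    · obtain ⟨Ω, hΩ⟩ : ∃ Ω, IsShadow (volume.restrict E) (q • volume) a b Ω :=
        exists_isShadow hab (by
          rwa [Measure.restrict_apply measurableSet_Ioo, inter_eq_right.2 hEI])
      rw [pow_succ', pow_succ, mul_assoc, mul_assoc]
      rcases ih Ω hΩ.isOpen.measurableSet hΩ.subset with hk | hk
      · exact Or.inl ((hΩ.volume_le_mul hq hE hEI).trans (by gcongr))
      · exact Or.inr (hk.trans (by gcongr; exact h.measure_shadow_le hE hΩ))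

theorem HalfMass.volume_lt_le (h : HalfMass (volume.withDensity u) q) (hq : q < 1)
    (hu : Measurable u) (hab : a < b) {L : ℝ≥0∞}
    (hL : volume.withDensity u (Ioo a b) = L * volume (Ioo a b)) (hL0 : L ≠ 0) (hLt : L ≠ ∞)
    (k : ℕ) : volume ({x | u x < (1 / 2) ^ k * (L / 2)} ∩ Ioo a b) ≤ q ^ k * volume (Ioo a b) := by
  set E := {x | u x < (1 / 2) ^ k * (L / 2)} ∩ Ioo a b
  have hE : MeasurableSet E := (measurableSet_lt hu measurable_const).inter measurableSet_Ioo
  refine (h.volume_le_or_measure_le hq hab k E hE inter_subset_right).resolve_right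
    (not_le.2 ?_)
  have hpow : (2 : ℝ≥0∞) ^ k * (1 / 2) ^ k = 1 := by
    rw [← mul_pow, ENNReal.mul_div_cancel two_ne_zero ENNReal.ofNat_ne_top, one_pow]
  calc 2 ^ k * volume.withDensity u E
      ≤ 2 ^ k * ((1 / 2) ^ k * (L / 2) * volume (Ioo a b)) := by
        gcongr 2 ^ k * ?_
        refine (withDensity_le_mul_of_forall_mem_le hE fun x hx => le_of_lt hx.1).trans ?_
        gcongr
        exact inter_subset_right
    _ = L / 2 * volume (Ioo a b) := by rw [← mul_assoc, ← mul_assoc, hpow, one_mul]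
    _ < L * volume (Ioo a b) := by
        have hvol : volume (Ioo a b) ≠ 0 := by simpa using hab
        exact (ENNReal.mul_lt_mul_iff_left hvol measure_Ioo_lt_top.ne).2
          (ENNReal.half_lt_self hL0 hLt)
    _ = volume.withDensity u (Ioo a b) := hL.symm

end HalfMass

section NegativePowers

lemma rpow_neg_le_tsum {θ L x : ℝ≥0∞} {s : ℝ} (hθ : θ ≤ 1) (hθ0 : θ ≠ 0) (hs : 0 ≤ s)
    (hL : L ≠ 0) (hLt : L ≠ ∞) :
    x ^ (-s) ≤
      L ^ (-s) * (1 + ∑' k : ℕ, (θ ^ (-s)) ^ (k + 1) * if x < θ ^ k * L then 1 else 0) := by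
  have antitone {y z : ℝ≥0∞} (h : y ≤ z) : z ^ (-s) ≤ y ^ (-s) := by
    rw [ENNReal.rpow_neg, ENNReal.rpow_neg]
    exact ENNReal.inv_le_inv.2 (ENNReal.rpow_le_rpow h hs)
  have hR : 1 ≤ θ ^ (-s) := by simpa using antitone hθ
  classical
  by_cases hex : ∃ k : ℕ, θ ^ k * L ≤ x
  · rcases hk : Nat.find hex with _ | k
    · have hLx : L ≤ x := by simpa [hk] using Nat.find_spec hex
      exact (antitone hLx).trans (le_mul_of_one_le_right' le_self_add)
    have hle : θ ^ (k + 1) * L ≤ x := hk ▸ Nat.find_spec hex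
    have hlt : x < θ ^ k * L := not_le.1 (Nat.find_min hex (hk ▸ k.lt_succ_self))
    calc x ^ (-s) ≤ (θ ^ (k + 1) * L) ^ (-s) := antitone hle
      _ = L ^ (-s) * ((θ ^ (-s)) ^ (k + 1) * if x < θ ^ k * L then 1 else 0) := by
        rw [if_pos hlt, mul_one, ENNReal.mul_rpow_of_ne_zero (pow_ne_zero _ hθ0) hL, mul_comm,
          ← ENNReal.rpow_natCast, ← ENNReal.rpow_natCast, ← ENNReal.rpow_mul, ← ENNReal.rpow_mul,
          mul_comm (-s)]
      _ ≤ _ := by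
        gcongr
        exact (ENNReal.le_tsum k).trans le_add_self
  · push Not at hex
    have htop : ∑' k : ℕ, (θ ^ (-s)) ^ (k + 1) * (if x < θ ^ k * L then 1 else 0 : ℝ≥0∞) = ∞ := by
      rw [eq_top_iff, ← ENNReal.tsum_const_eq_top_of_ne_zero (α := ℕ) one_ne_zero]
      refine ENNReal.tsum_le_tsum fun k => ?_
      rw [if_pos (hex k), mul_one]
      exact one_le_pow₀ hR
    rw [htop, add_top, ENNReal.mul_top (by simp [ENNReal.rpow_eq_zero_iff, hL, hLt])]
    exact le_top

lemma lintegral_rpow_neg_le_of_measure_lt_le {α : Type*} [MeasurableSpace α] {μ : Measure α}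
    {u : α → ℝ≥0∞} (hu : Measurable u) {θ L q : ℝ≥0∞} {s : ℝ} (hθ : θ ≤ 1) (hθ0 : θ ≠ 0)
    (hs : 0 ≤ s) (hL : L ≠ 0) (hLt : L ≠ ∞)
    (h : ∀ k : ℕ, μ {x | u x < θ ^ k * L} ≤ q ^ k * μ univ) :
    ∫⁻ x, u x ^ (-s) ∂μ ≤
      L ^ (-s) * (1 + ∑' k : ℕ, (θ ^ (-s)) ^ (k + 1) * q ^ k) * μ univ := by
  let F (k : ℕ) (x : α) : ℝ≥0∞ := if u x < θ ^ k * L then 1 else 0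
  have hset (k : ℕ) : MeasurableSet {x | u x < θ ^ k * L} := measurableSet_lt hu measurable_const
  have hF (k : ℕ) : Measurable (F k) := Measurable.ite (hset k) measurable_const measurable_const
  have hFint (k : ℕ) : ∫⁻ x, F k x ∂μ = μ {x | u x < θ ^ k * L} := by
    rw [← lintegral_indicator_one (hset k)]
    exact lintegral_congr fun x => by simp [F, indicator_apply]
  have hsum : Measurable fun x => 1 + ∑' k : ℕ, (θ ^ (-s)) ^ (k + 1) * F k x :=
    measurable_const.add (Measurable.tsum fun k => (hF k).const_mul _)
  calc ∫⁻ x, u x ^ (-s) ∂μ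
      ≤ ∫⁻ x, L ^ (-s) * (1 + ∑' k : ℕ, (θ ^ (-s)) ^ (k + 1) * F k x) ∂μ :=
        lintegral_mono fun x => rpow_neg_le_tsum hθ hθ0 hs hL hLt
    _ = L ^ (-s) * (μ univ + ∑' k : ℕ, (θ ^ (-s)) ^ (k + 1) * μ {x | u x < θ ^ k * L}) := by
      rw [lintegral_const_mul _ hsum, lintegral_add_left measurable_const, lintegral_one,
        lintegral_tsum fun k => ((hF k).const_mul _).aemeasurable]
      simp only [lintegral_const_mul _ (hF _), hFint]
    _ ≤ L ^ (-s) * (μ univ + ∑' k : ℕ, (θ ^ (-s)) ^ (k + 1) * (q ^ k * μ univ)) := by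
      gcongr with k
      exact h k
    _ = L ^ (-s) * (1 + ∑' k : ℕ, (θ ^ (-s)) ^ (k + 1) * q ^ k) * μ univ := by
      simp only [← mul_assoc]
      rw [ENNReal.tsum_mul_right, mul_assoc, add_mul, one_mul]

lemma one_add_tsum_pow_succ_mul_pow_le {K : ℝ} (hK : 1 ≤ K) {R q : ℝ≥0∞}
    (hR : R ≤ ENNReal.ofReal (1 + 1 / (2 * K))) (hq : q ≤ ENNReal.ofReal (1 - 1 / K)) :
    1 + ∑' k : ℕ, R ^ (k + 1) * q ^ k ≤ ENNReal.ofReal (5 * K) := by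
  have hx1 : 1 / (2 * K) ≤ 1 := by rw [div_le_one (by positivity)]; linarith
  have hRq : R * q ≤ ENNReal.ofReal (1 - 1 / (2 * K)) := by
    calc R * q ≤ ENNReal.ofReal (1 + 1 / (2 * K)) * ENNReal.ofReal (1 - 1 / K) := by gcongr
      _ = ENNReal.ofReal ((1 + 1 / (2 * K)) * (1 - 1 / K)) :=
        (ENNReal.ofReal_mul (by positivity)).symm
      _ ≤ ENNReal.ofReal (1 - 1 / (2 * K)) := by
        refine ENNReal.ofReal_le_ofReal ?_
        have hsq : (1 + 1 / (2 * K)) * (1 - 1 / K) =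
            1 - 1 / (2 * K) - 2 * (1 / (2 * K)) ^ 2 := by field_simp; ring
        rw [hsq]
        linarith [sq_nonneg (1 / (2 * K))]
  have hinv : (1 - R * q)⁻¹ ≤ ENNReal.ofReal (2 * K) := by
    refine ENNReal.inv_le_iff_inv_le.1 ?_
    calc (ENNReal.ofReal (2 * K))⁻¹ = 1 - ENNReal.ofReal (1 - 1 / (2 * K)) := by
          rw [← ENNReal.ofReal_inv_of_pos (by positivity), ← ENNReal.ofReal_one,
            ← ENNReal.ofReal_sub _ (by linarith), one_div, sub_sub_cancel]
      _ ≤ 1 - R * q := by gcongr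
  calc 1 + ∑' k : ℕ, R ^ (k + 1) * q ^ k = 1 + R * (1 - R * q)⁻¹ := by
        rw [← ENNReal.tsum_geometric, ← ENNReal.tsum_mul_left]
        simp only [mul_pow, pow_succ']
        ring_nf
    _ ≤ ENNReal.ofReal K + ENNReal.ofReal 2 * ENNReal.ofReal (2 * K) := by
      gcongr
      · rwa [ENNReal.one_le_ofReal]
      · exact hR.trans (ENNReal.ofReal_le_ofReal (by linarith))
    _ = ENNReal.ofReal (5 * K) := by
      rw [← ENNReal.ofReal_mul zero_le_two, ← ENNReal.ofReal_add (by positivity) (by positivity)]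
      ring_nf

lemma half_rpow_neg_le {s : ℝ} (hs : 0 ≤ s) (hs1 : s ≤ 1) :
    (1 / 2 : ℝ≥0∞) ^ (-s) ≤ ENNReal.ofReal (1 + s) := by
  rw [ENNReal.rpow_neg, ← ENNReal.inv_rpow, one_div, inv_inv, ← ENNReal.ofReal_ofNat,
    ENNReal.ofReal_rpow_of_nonneg zero_le_two hs]
  refine ENNReal.ofReal_le_ofReal ?_
  have bernoulli := rpow_one_add_le_one_add_mul_self (s := 1) (by norm_num) hs hs1
  rwa [one_add_one_eq_two, mul_one] at bernoulli

theorem HalfMass.lintegral_rpow_neg_le {u : ℝ → ℝ≥0∞} (hu : Measurable u) {K : ℝ≥0}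
    (h : HalfMass (volume.withDensity u) (1 - K⁻¹)) (hK : 1 ≤ K) {s : ℝ} (hs : 0 ≤ s)
    (hsK : 2 * K * s ≤ 1) {a b : ℝ} (hab : a < b) {L : ℝ≥0∞}
    (hL : volume.withDensity u (Ioo a b) = L * volume (Ioo a b)) (hL0 : L ≠ 0) (hLt : L ≠ ∞) :
    ∫⁻ x in Ioo a b, u x ^ (-s) ≤ 10 * K * L ^ (-s) * volume (Ioo a b) := by
  have hK' : (1 : ℝ) ≤ K := hK
  have hs_le : s ≤ 1 / (2 * K) := by rw [le_div_iff₀ (by positivity)]; linarith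
  have hhalf_le : 1 / (2 * (K : ℝ)) ≤ 1 := by rw [div_le_one (by positivity)]; linarith
  have htwo : (1 / 2 : ℝ≥0∞) ^ (-s) ≤ ENNReal.ofReal (1 + 1 / (2 * K)) :=
    (half_rpow_neg_le hs (by linarith)).trans (ENNReal.ofReal_le_ofReal (by linarith))
  have hq : ((1 - K⁻¹ : ℝ≥0) : ℝ≥0∞) ≤ ENNReal.ofReal (1 - 1 / K) := by
    rw [ENNReal.ofReal_sub _ (by positivity), one_div, ENNReal.ofReal_one,
      ENNReal.ofReal_inv_of_pos (by positivity), ENNReal.ofReal_coe_nnreal, ENNReal.coe_sub,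
      ENNReal.coe_inv (by positivity), ENNReal.coe_one]
  have hdecay := lintegral_rpow_neg_le_of_measure_lt_le (μ := volume.restrict (Ioo a b)) hu
    (θ := 1 / 2) (L := L / 2) (q := (1 - K⁻¹ : ℝ≥0)) (s := s) (by simp) (by simp) hs
    (by simpa using hL0) (ENNReal.div_ne_top hLt two_ne_zero) fun k => by
      rw [Measure.restrict_apply (measurableSet_lt hu measurable_const),
        Measure.restrict_apply_univ]
      exact h.volume_lt_le (tsub_lt_self one_pos (by positivity)) hu hab hL hL0 hLt k
  rw [Measure.restrict_apply_univ] at hdecay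
  refine hdecay.trans (mul_le_mul_left ?_ _)
  calc (L / 2) ^ (-s) * (1 + ∑' k : ℕ, ((1 / 2 : ℝ≥0∞) ^ (-s)) ^ (k + 1) *
        ((1 - K⁻¹ : ℝ≥0) : ℝ≥0∞) ^ k)
      ≤ (L ^ (-s) * ENNReal.ofReal 2) * ENNReal.ofReal (5 * K) := by
        gcongr
        · rw [div_eq_mul_one_div, ENNReal.mul_rpow_of_ne_zero hL0 (by simp)]
          gcongr
          exact htwo.trans (ENNReal.ofReal_le_ofReal (by linarith))
        · exact one_add_tsum_pow_succ_mul_pow_le hK' htwo hq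
    _ = 10 * K * L ^ (-s) := by
        rw [mul_assoc, ← ENNReal.ofReal_mul zero_le_two, ← mul_assoc, mul_comm,
          ENNReal.ofReal_mul (by norm_num), ENNReal.ofReal_coe_nnreal]
        norm_num

end NegativePowers

section OneDimensional

variable {v v' : ℝ → ℝ} {a b p : ℝ}

lemma apExpr_congr_ae {α : Type*} [MeasureSpace α] {w w' : α → ℝ} {Q : Set α} (p : ℝ)
    (h : w =ᵐ[volume.restrict Q] w') : apExpr p w Q = apExpr p w' Q := by
  unfold apExpr
  congr 1
  · exact laverage_congr (h.fun_comp ENNReal.ofReal)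
  congr 1
  · exact essSup_congr_ae (h.fun_comp fun t => (ENNReal.ofReal t)⁻¹)
  · exact congrArg (· ^ (p - 1))
      (laverage_congr (h.fun_comp fun t => ENNReal.ofReal t ^ (-(1 / (p - 1)))))

lemma apConst_congr_ae (p : ℝ) (h : v =ᵐ[volume] v') : apConst p v = apConst p v' := by
  unfold apConst
  simp only [apExpr_congr_ae p (ae_restrict_of_ae h)]

lemma maximalFun_congr_ae {f g : ℝ → ℝ≥0∞} (h : f =ᵐ[volume] g) : maximalFun f = maximalFun g := by
  unfold maximalFun
  simp only [laverage_congr (ae_restrict_of_ae h)]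

lemma aInftyConst_congr_ae (h : v =ᵐ[volume] v') : aInftyConst v = aInftyConst v' := by
  have hofReal : (fun y => ENNReal.ofReal (v y)) =ᵐ[volume] fun y => ENNReal.ofReal (v' y) :=
    h.fun_comp ENNReal.ofReal
  have hnum (a b : ℝ) : maximalFun ((Icc a b).indicator fun y => ENNReal.ofReal (v y)) =
      maximalFun ((Icc a b).indicator fun y => ENNReal.ofReal (v' y)) :=
    maximalFun_congr_ae hofReal.indicator
  have hden (a b : ℝ) :
      ∫⁻ y in Icc a b, ENNReal.ofReal (v y) = ∫⁻ y in Icc a b, ENNReal.ofReal (v' y) :=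
    lintegral_congr_ae (ae_restrict_of_ae hofReal)
  simp only [aInftyConst, hnum, hden]

lemma apExpr_eq_zero_of_lintegral_eq_zero {α : Type*} [MeasureSpace α] {w : α → ℝ} {Q : Set α}
    (p : ℝ) (h : ∫⁻ x in Q, ENNReal.ofReal (w x) = 0) : apExpr p w Q = 0 := by
  rw [apExpr, setLAverage_eq, h, ENNReal.zero_div, zero_mul]

lemma lintegral_Icc_lt_top (hv : LocallyIntegrable v volume) (a b : ℝ) :
    ∫⁻ x in Icc a b, ENNReal.ofReal (v x) < ∞ :=
  (hv.integrableOn_isCompact isCompact_Icc).lintegral_lt_top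

lemma isLocallyFiniteMeasure_withDensity_ofReal_of_locallyIntegrable
    (hv : LocallyIntegrable v volume) :
    IsLocallyFiniteMeasure (volume.withDensity fun x => ENNReal.ofReal (v x)) := by
  refine ⟨fun x => ⟨Icc (x - 1) (x + 1), Icc_mem_nhds (by linarith) (by linarith), ?_⟩⟩
  rw [withDensity_apply _ measurableSet_Icc]
  exact lintegral_Icc_lt_top hv _ _

lemma div_le_aInftyConst (v : ℝ → ℝ) (hab : a < b) :
    (∫⁻ x in Icc a b, maximalFun ((Icc a b).indicator fun y => ENNReal.ofReal (v y)) x) /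
      ∫⁻ x in Icc a b, ENNReal.ofReal (v x) ≤ aInftyConst v := by
  refine le_iSup_of_le a (le_iSup_of_le b ?_)
  rw [iSup_pos hab]

lemma lintegral_maximalFun_le_aInftyConst_mul (hv : LocallyIntegrable v volume)
    (hA : aInftyConst v ≠ ∞) (hab : a < b) :
    ∫⁻ x in Icc a b, maximalFun ((Icc a b).indicator fun y => ENNReal.ofReal (v y)) x ≤
      aInftyConst v * ∫⁻ x in Icc a b, ENNReal.ofReal (v x) := by
  rw [← ENNReal.div_le_iff_le_mul (.inr hA) (.inl (lintegral_Icc_lt_top hv a b).ne)]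
  exact div_le_aInftyConst v hab

lemma one_le_aInftyConst (hv : LocallyIntegrable v volume) (hab : a < b)
    (h0 : ∫⁻ x in Icc a b, ENNReal.ofReal (v x) ≠ 0) : 1 ≤ aInftyConst v := by
  refine le_trans ?_ (div_le_aInftyConst v hab)
  rw [ENNReal.le_div_iff_mul_le (.inl h0) (.inl (lintegral_Icc_lt_top hv a b).ne), one_mul]
  have : IsFiniteMeasure (volume.restrict (Icc a b)) := ⟨by simp⟩
  rw [← lintegral_laverage]
  exact setLIntegral_mono' measurableSet_Icc fun x hx =>
    laverage_le_maximalFun_indicator hab le_rfl hx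

lemma halfMass_of_aInftyConst_le (hvm : Measurable v) (hv : LocallyIntegrable v volume) {N : ℕ}
    (hN : N ≠ 0) (hA : 8 * aInftyConst v ≤ N) :
    HalfMass (volume.withDensity fun x => ENNReal.ofReal (v x)) (1 - (2 ^ (N + 2))⁻¹) := by
  have := isLocallyFiniteMeasure_withDensity_ofReal_of_locallyIntegrable hv
  have hfin : aInftyConst v ≠ ∞ := by
    intro h
    simp [h] at hA
  refine halfMass_of_maximalFun_le hvm.ennreal_ofReal hN fun a b hab => ?_
  calc _ ≤ 8 * (aInftyConst v * ∫⁻ x in Icc a b, ENNReal.ofReal (v x)) := by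
        gcongr 8 * ?_
        exact lintegral_maximalFun_le_aInftyConst_mul hv hfin hab
    _ ≤ _ := by
        rw [← mul_assoc]
        gcongr

lemma HalfMass.laverage_rpow_neg_le (hvm : Measurable v) (hv : LocallyIntegrable v volume)
    {K : ℝ≥0} (h : HalfMass (volume.withDensity fun x => ENNReal.ofReal (v x)) (1 - K⁻¹))
    (hK : 1 ≤ K) {s : ℝ} (hs : 0 ≤ s) (hsK : 2 * K * s ≤ 1) (hab : a < b)
    (h0 : ⨍⁻ x in Icc a b, ENNReal.ofReal (v x) ∂volume ≠ 0) :
    ⨍⁻ x in Icc a b, ENNReal.ofReal (v x) ^ (-s) ∂volume ≤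
      10 * K * (⨍⁻ x in Icc a b, ENNReal.ofReal (v x) ∂volume) ^ (-s) := by
  have := isLocallyFiniteMeasure_withDensity_ofReal_of_locallyIntegrable hv
  have hIoo := Ioo_ae_eq_Icc (μ := (volume : Measure ℝ)) (a := a) (b := b)
  have hvol0 : volume (Ioo a b) ≠ 0 := by simpa using hab
  have hvolt : volume (Ioo a b) ≠ ∞ := by simp
  simp only [← Measure.restrict_congr_set hIoo] at h0 ⊢
  have hfin : ∫⁻ x in Ioo a b, ENNReal.ofReal (v x) ≠ ∞ := by
    rw [setLIntegral_congr hIoo]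
    exact (lintegral_Icc_lt_top hv a b).ne
  rw [setLAverage_eq]
  refine ENNReal.div_le_of_le_mul <|
    h.lintegral_rpow_neg_le hvm.ennreal_ofReal hK hs hsK hab ?_ h0 ?_
  · rw [withDensity_apply _ measurableSet_Ioo, setLAverage_eq, ENNReal.div_mul_cancel hvol0 hvolt]
  · rw [setLAverage_eq]
    exact ENNReal.div_ne_top hfin hvol0

lemma HalfMass.apExpr_le (hvm : Measurable v) (hv : LocallyIntegrable v volume) {K : ℝ≥0}
    (h : HalfMass (volume.withDensity fun x => ENNReal.ofReal (v x)) (1 - K⁻¹)) (hK : 1 ≤ K)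
    (hp : 2 * K ≤ p - 1) (hab : a < b) :
    apExpr p v (Icc a b) ≤ (10 * K) ^ (p - 1) := by
  have hp1 : 0 < p - 1 := by linarith
  set L := ⨍⁻ x in Icc a b, ENNReal.ofReal (v x) ∂volume with hL
  rcases eq_or_ne L 0 with h0 | h0
  · simp [apExpr, ← hL, h0]
  have havg : ⨍⁻ x in Icc a b, ENNReal.ofReal (v x) ^ (-(1 / (p - 1))) ∂volume ≤
      10 * K * L ^ (-(1 / (p - 1))) :=
    h.laverage_rpow_neg_le hvm hv hK (by positivity)
      (by rwa [mul_one_div, div_le_one hp1]) hab h0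
  rw [apExpr, if_neg (by linarith)]
  calc _ ≤ L * (10 * K * L ^ (-(1 / (p - 1)))) ^ (p - 1) := by gcongr
    _ = (10 * K) ^ (p - 1) * (L * L⁻¹) := by
      rw [ENNReal.mul_rpow_of_nonneg _ _ hp1.le, ← ENNReal.rpow_mul, neg_mul, one_div,
        inv_mul_cancel₀ hp1.ne', ENNReal.rpow_neg_one]
      ring
    _ ≤ _ := mul_le_of_le_one_right' (ENNReal.mul_inv_le_one L)

lemma exists_nat_ge_two_pow_le_exp {A : ℝ} (hA : 1 ≤ A) :
    ∃ N : ℕ, 8 * A ≤ N ∧ 10 * (2 : ℝ) ^ (N + 2) ≤ Real.exp (15 * A) := by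
  refine ⟨⌈8 * A⌉₊, Nat.le_ceil _, ?_⟩
  have hN : (⌈8 * A⌉₊ : ℝ) < 8 * A + 1 := Nat.ceil_lt_add_one (by linarith)
  calc 10 * (2 : ℝ) ^ (⌈8 * A⌉₊ + 2) ≤ 2 ^ (⌈8 * A⌉₊ + 6) := by
        rw [pow_add, pow_add]
        linarith [pow_pos (two_pos (α := ℝ)) ⌈8 * A⌉₊]
    _ ≤ Real.exp 1 ^ (⌈8 * A⌉₊ + 6) := by
        gcongr
        linarith [Real.add_one_le_exp 1]
    _ = Real.exp (⌈8 * A⌉₊ + 6) := by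
        rw [← Real.exp_nat_mul]
        push_cast
        rw [mul_one]
    _ ≤ Real.exp (15 * A) := Real.exp_le_exp.2 (by linarith)

lemma apConst_le_exp_of_measurable (hvm : Measurable v) (hv : LocallyIntegrable v volume) {A : ℝ}
    (hA : aInftyConst v ≤ ENNReal.ofReal A) (hp : Real.exp (15 * A) ≤ p) :
    apConst p v ≤ ENNReal.ofReal (Real.exp (15 * A * p)) := by
  refine iSup_le fun a => iSup_le fun b => iSup_le fun hab => ?_
  rcases eq_or_ne (∫⁻ x in Icc a b, ENNReal.ofReal (v x)) 0 with h0 | h0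
  · simp [apExpr_eq_zero_of_lintegral_eq_zero p h0]
  have hA1 : 1 ≤ A := ENNReal.one_le_ofReal.1 ((one_le_aInftyConst hv hab h0).trans hA)
  obtain ⟨N, hN, hNexp⟩ := exists_nat_ge_two_pow_le_exp hA1
  have hAN : 8 * aInftyConst v ≤ N := by
    calc 8 * aInftyConst v ≤ 8 * ENNReal.ofReal A := by gcongr
      _ = ENNReal.ofReal (8 * A) := by rw [ENNReal.ofReal_mul (by norm_num), ENNReal.ofReal_ofNat]
      _ ≤ N := ENNReal.ofReal_le_of_le_toReal (by simpa using hN)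
  have hK : (1 : ℝ) ≤ 2 ^ (N + 2) := one_le_pow₀ one_le_two
  have hp1 : (2 : ℝ) * 2 ^ (N + 2) ≤ p - 1 := by linarith
  have hN0 : N ≠ 0 := by
    rintro rfl
    norm_num at hN
    linarith
  have key := (halfMass_of_aInftyConst_le hvm hv hN0 hAN).apExpr_le (p := p) hvm hv
    (one_le_pow₀ one_le_two) (by push_cast; exact hp1) hab
  calc apExpr p v (Icc a b) ≤ ENNReal.ofReal ((10 * 2 ^ (N + 2)) ^ (p - 1)) := by
        rw [← ENNReal.ofReal_rpow_of_nonneg (by positivity) (by linarith)]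
        simpa [ENNReal.ofReal_mul, ENNReal.ofReal_pow] using key
    _ ≤ ENNReal.ofReal (Real.exp (15 * A) ^ (p - 1)) := by
        gcongr
        linarith
    _ ≤ ENNReal.ofReal (Real.exp (15 * A * p)) := by
        rw [← Real.exp_mul]
        gcongr
        linarith

theorem apConst_le_exp (hv : LocallyIntegrable v volume) {A : ℝ}
    (hA : aInftyConst v ≤ ENNReal.ofReal A) (hp : Real.exp (15 * A) ≤ p) :
    apConst p v ≤ ENNReal.ofReal (Real.exp (15 * A * p)) := by
  obtain ⟨v', hv'm, hvv'⟩ := hv.aestronglyMeasurable.aemeasurable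
  rw [apConst_congr_ae p hvv']
  rw [aInftyConst_congr_ae hvv'] at hA
  exact apConst_le_exp_of_measurable hv'm (hv.congr hvv') hA hp

end OneDimensional

section Duality

variable {α : Type*} [MeasurableSpace α] {μ : Measure α} {p : ℝ} {D : ℝ≥0∞}

lemma lintegral_rpow_le_lintegral_rpow_mul_mul (hp : 1 < p) {f u : α → ℝ≥0∞}
    (hf : AEMeasurable f μ) (hu : AEMeasurable u μ) (hut : ∀ᵐ x ∂μ, u x ≠ ∞)
    (hint : ∫⁻ x, u x ^ (-(1 / (p - 1))) ∂μ ≠ ∞) :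
    (∫⁻ x, f x ∂μ) ^ p ≤
      (∫⁻ x, f x ^ p * u x ∂μ) * (∫⁻ x, u x ^ (-(1 / (p - 1))) ∂μ) ^ (p - 1) := by
  have hp0 : 0 < p := by linarith
  have hp1 : 0 < p - 1 := by linarith
  have hu0 : ∀ᵐ x ∂μ, u x ≠ 0 := by
    filter_upwards [ae_lt_top' (hu.pow_const _) hint] with x hx h0
    simp [h0, hp1] at hx
  have hsplit : ∫⁻ x, f x ∂μ = ∫⁻ x, (f x * u x ^ (1 / p)) * u x ^ (-(1 / p)) ∂μ := by
    refine lintegral_congr_ae ?_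
    filter_upwards [hut, hu0] with x hxt hx0
    rw [mul_assoc, ← ENNReal.rpow_add _ _ hx0 hxt, add_neg_cancel, ENNReal.rpow_zero, mul_one]
  have hleft (x : α) : (f x * u x ^ (1 / p)) ^ p = f x ^ p * u x := by
    rw [ENNReal.mul_rpow_of_nonneg _ _ hp0.le, ← ENNReal.rpow_mul, one_div_mul_cancel hp0.ne',
      ENNReal.rpow_one]
  have hright (x : α) : (u x ^ (-(1 / p))) ^ (p / (p - 1)) = u x ^ (-(1 / (p - 1))) := by
    rw [← ENNReal.rpow_mul]
    congr 1
    field_simp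
  have holder := ENNReal.lintegral_mul_le_Lp_mul_Lq μ (Real.HolderConjugate.conjExponent hp)
    (hf.mul (hu.pow_const (1 / p))) (hu.pow_const (-(1 / p)))
  simp only [Pi.mul_apply, Real.conjExponent, hleft, hright] at holder
  rw [hsplit]
  refine (ENNReal.rpow_le_rpow holder hp0.le).trans_eq ?_
  rw [ENNReal.mul_rpow_of_nonneg _ _ hp0.le, ← ENNReal.rpow_mul, ← ENNReal.rpow_mul,
    one_div_mul_cancel hp0.ne', ENNReal.rpow_one]
  congr 2
  field_simp

lemma lintegral_le_essSup_inv_mul {f u : α → ℝ≥0∞} (hf : AEMeasurable f μ)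
    (hu : AEMeasurable u μ) (hut : ∀ᵐ x ∂μ, u x ≠ ∞)
    (hS : essSup (fun x => (u x)⁻¹) μ ≠ ∞) :
    ∫⁻ x, f x ∂μ ≤ essSup (fun x => (u x)⁻¹) μ * ∫⁻ x, f x * u x ∂μ := by
  calc ∫⁻ x, f x ∂μ ≤ ∫⁻ x, essSup (fun x => (u x)⁻¹) μ * (f x * u x) ∂μ := by
        refine lintegral_mono_ae ?_
        filter_upwards [hut, ENNReal.ae_le_essSup fun x => (u x)⁻¹] with x hxt hx
        have hx0 : u x ≠ 0 := fun h0 => hS (top_le_iff.1 (by simpa [h0] using hx))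
        calc f x = (u x)⁻¹ * (f x * u x) := by
              rw [mul_left_comm, ENNReal.inv_mul_cancel hx0 hxt, mul_one]
          _ ≤ _ := by gcongr
    _ = _ := lintegral_const_mul'' _ (hf.mul hu)

lemma rpow_mul_le_of_rpow_mul_le_mul {Y U : ℝ≥0∞} (hp : 1 < p) (hY : Y ≠ ∞)
    (h : Y ^ p * U ≤ D * Y) : Y ^ (p - 1) * U ≤ D := by
  rcases eq_or_ne Y 0 with rfl | hY0
  · rw [ENNReal.zero_rpow_of_pos (by linarith), zero_mul]
    exact zero_le
  have hYp : Y ^ p = Y ^ (p - 1) * Y := by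
    simpa using ENNReal.rpow_add (p - 1) 1 hY0 hY
  rw [hYp, mul_right_comm] at h
  exact (ENNReal.mul_le_mul_iff_left hY0 hY).1 h

lemma rpow_mul_le_self_of_le_rpow_neg {g u : ℝ≥0∞} (hp : 1 < p) (hg : g ≤ u ^ (-(1 / (p - 1)))) :
    g ^ p * u ≤ g := by
  have hp1 : 0 < p - 1 := by linarith
  have hgu : g ^ (p - 1) ≤ u⁻¹ := by
    calc g ^ (p - 1) ≤ (u ^ (-(1 / (p - 1)))) ^ (p - 1) := by gcongr
      _ = u⁻¹ := by
        rw [← ENNReal.rpow_mul, neg_mul, one_div_mul_cancel hp1.ne', ENNReal.rpow_neg_one]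
  calc g ^ p * u = g * (g ^ (p - 1) * u) := by
        conv_lhs => rw [← add_sub_cancel 1 p]
        rw [ENNReal.rpow_add_of_nonneg _ _ zero_le_one hp1.le, ENNReal.rpow_one, mul_assoc]
    _ ≤ g * (u⁻¹ * u) := by gcongr
    _ ≤ g := mul_le_of_le_one_right' (ENNReal.inv_mul_le_one u)

lemma lintegral_rpow_neg_rpow_mul_le [IsFiniteMeasure μ] (hp : 1 < p) {u : α → ℝ≥0∞}
    (hu : Measurable u)
    (h : ∀ f : α → ℝ≥0∞, Measurable f →
      (∫⁻ x, f x ∂μ) ^ p * ∫⁻ x, u x ∂μ ≤ D * ∫⁻ x, f x ^ p * u x ∂μ) :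
    (∫⁻ x, u x ^ (-(1 / (p - 1))) ∂μ) ^ (p - 1) * ∫⁻ x, u x ∂μ ≤ D := by
  have hp1 : 0 < p - 1 := by linarith
  let g (n : ℕ) (x : α) : ℝ≥0∞ := min (u x ^ (-(1 / (p - 1)))) n
  have hgm (n : ℕ) : Measurable (g n) := (hu.pow_const _).min measurable_const
  have hg_iSup (x : α) : u x ^ (-(1 / (p - 1))) = ⨆ n, g n x := by
    simp only [g, ← inf_iSup_eq, ENNReal.iSup_natCast, inf_top_eq]
  have hgn (n : ℕ) : (∫⁻ x, g n x ∂μ) ^ (p - 1) * ∫⁻ x, u x ∂μ ≤ D := by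
    refine rpow_mul_le_of_rpow_mul_le_mul hp ?_ ((h (g n) (hgm n)).trans ?_)
    · refine ne_top_of_le_ne_top ?_ (lintegral_mono fun x => min_le_right _ _)
      rw [lintegral_const]
      exact ENNReal.mul_ne_top (ENNReal.natCast_ne_top n) (measure_ne_top μ univ)
    · gcongr D * ?_
      exact lintegral_mono fun x => rpow_mul_le_self_of_le_rpow_neg hp (min_le_left _ _)
  simp only [hg_iSup]
  rw [lintegral_iSup hgm fun m n hmn x => by dsimp only [g]; gcongr,
    ← ENNReal.orderIsoRpow_apply _ hp1, OrderIso.map_iSup, ENNReal.iSup_mul]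
  exact iSup_le hgn

lemma lintegral_mul_essSup_inv_le [IsFiniteMeasure μ] {u : α → ℝ≥0∞} (hu : Measurable u)
    (h : ∀ f : α → ℝ≥0∞, Measurable f →
      (∫⁻ x, f x ∂μ) * ∫⁻ x, u x ∂μ ≤ D * ∫⁻ x, f x * u x ∂μ) :
    (∫⁻ x, u x ∂μ) * essSup (fun x => (u x)⁻¹) μ ≤ D := by
  have hle : (fun _ => ∫⁻ x, u x ∂μ) ≤ᵐ[μ] fun x => D * u x := by
    refine ae_le_of_forall_setLIntegral_le_of_sigmaFinite measurable_const fun E hE _ => ?_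
    have hE' := h (E.indicator 1) (measurable_one.indicator hE)
    simp only [← indicator_mul_left E 1 u, Pi.one_apply, one_mul, lintegral_indicator_one hE,
      lintegral_indicator hE] at hE'
    rw [setLIntegral_const, lintegral_const_mul _ hu, mul_comm]
    exact hE'
  rw [← ENNReal.essSup_const_mul]
  refine essSup_le_of_ae_le D ?_
  filter_upwards [hle] with x hx
  exact ENNReal.div_le_of_le_mul hx

end Duality

section Testing

variable {α : Type*} [MeasureSpace α] {p : ℝ} {C : ℝ≥0∞}

/-- The testing form of the `A_p` condition of `W` on `Q`: the average operator over `Q` is bounded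
on `L^p(W)`. Unlike in the Muckenhoupt expression, both sides are linear in `W`, so that the
condition survives integration over a parameter. -/
def TestingCondition (p : ℝ) (C : ℝ≥0∞) (W : α → ℝ≥0∞) (Q : Set α) : Prop :=
  ∀ f : α → ℝ≥0∞, Measurable f →
    (⨍⁻ x in Q, f x ∂volume) ^ p * ⨍⁻ x in Q, W x ∂volume ≤
      C * ⨍⁻ x in Q, f x ^ p * W x ∂volume

lemma testingCondition_one_of_apExpr_le {w : α → ℝ} {Q : Set α}
    (hw : AEMeasurable w (volume.restrict Q)) (hC : C ≠ ∞) (h : apExpr 1 w Q ≤ C) :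
    TestingCondition 1 C (fun x => ENNReal.ofReal (w x)) Q := by
  intro f hf
  rw [apExpr, if_pos rfl] at h
  set U := ⨍⁻ x in Q, ENNReal.ofReal (w x) ∂volume
  set S := essSup (fun x => (ENNReal.ofReal (w x))⁻¹) (volume.restrict Q)
  rcases eq_or_ne U 0 with h0 | h0
  · simp [h0]
  have hS : S ≠ ∞ := by
    rintro hS
    rw [hS, ENNReal.mul_top h0] at h
    exact hC (top_le_iff.1 h)
  have hfS : ⨍⁻ x in Q, f x ∂volume ≤ S * ⨍⁻ x in Q, f x * ENNReal.ofReal (w x) ∂volume := by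
    simp only [setLAverage_eq, ← mul_div_assoc]
    gcongr
    exact lintegral_le_essSup_inv_mul hf.aemeasurable hw.ennreal_ofReal
      (.of_forall fun _ => ENNReal.ofReal_ne_top) hS
  simp only [ENNReal.rpow_one]
  calc _ ≤ (S * ⨍⁻ x in Q, f x * ENNReal.ofReal (w x) ∂volume) * U := by gcongr
    _ = U * S * ⨍⁻ x in Q, f x * ENNReal.ofReal (w x) ∂volume := by ring
    _ ≤ _ := by gcongr

lemma testingCondition_of_apExpr_le_of_one_lt {w : α → ℝ} {Q : Set α}
    (hw : AEMeasurable w (volume.restrict Q)) (hp : 1 < p) (hC : C ≠ ∞) (h : apExpr p w Q ≤ C) :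
    TestingCondition p C (fun x => ENNReal.ofReal (w x)) Q := by
  intro f hf
  rw [apExpr, if_neg hp.ne'] at h
  set U := ⨍⁻ x in Q, ENNReal.ofReal (w x) ∂volume
  set X := ⨍⁻ x in Q, ENNReal.ofReal (w x) ^ (-(1 / (p - 1))) ∂volume
  rcases eq_or_ne U 0 with h0 | h0
  · simp [h0]
  have hX : X ≠ ∞ := by
    rintro hX
    rw [hX, ENNReal.top_rpow_of_pos (by linarith), ENNReal.mul_top h0] at h
    exact hC (top_le_iff.1 h)
  have holder : (⨍⁻ x in Q, f x ∂volume) ^ p ≤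
      (⨍⁻ x in Q, f x ^ p * ENNReal.ofReal (w x) ∂volume) * X ^ (p - 1) :=
    lintegral_rpow_le_lintegral_rpow_mul_mul hp hf.aemeasurable
      (hw.ennreal_ofReal.smul_measure _) (.of_forall fun _ => ENNReal.ofReal_ne_top) hX
  calc _ ≤ (⨍⁻ x in Q, f x ^ p * ENNReal.ofReal (w x) ∂volume) * X ^ (p - 1) * U := by gcongr
    _ = U * X ^ (p - 1) * ⨍⁻ x in Q, f x ^ p * ENNReal.ofReal (w x) ∂volume := by ring
    _ ≤ _ := by gcongr

theorem testingCondition_of_apExpr_le {w : α → ℝ} {Q : Set α}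
    (hw : AEMeasurable w (volume.restrict Q)) (hp : 1 ≤ p) (hC : C ≠ ∞) (h : apExpr p w Q ≤ C) :
    TestingCondition p C (fun x => ENNReal.ofReal (w x)) Q := by
  rcases hp.eq_or_lt with rfl | hp
  · exact testingCondition_one_of_apExpr_le hw hC h
  · exact testingCondition_of_apExpr_le_of_one_lt hw hp hC h

theorem TestingCondition.apExpr_le {w : α → ℝ} {Q : Set α} (hw : Measurable w) (hp : 1 ≤ p)
    (hQ0 : volume Q ≠ 0) (hQt : volume Q ≠ ∞)
    (h : TestingCondition p C (fun x => ENNReal.ofReal (w x)) Q) : apExpr p w Q ≤ C := by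
  have hμ : ((volume.restrict Q) univ)⁻¹ ≠ 0 := by simpa using hQt
  have : IsFiniteMeasure (((volume.restrict Q) univ)⁻¹ • volume.restrict Q) :=
    ⟨by simp [ENNReal.inv_mul_cancel hQ0 hQt]⟩
  rcases hp.eq_or_lt with rfl | hp
  · rw [apExpr, if_pos rfl, ← essSup_ennreal_smul_measure hμ]
    simp only [TestingCondition, ENNReal.rpow_one] at h
    exact lintegral_mul_essSup_inv_le hw.ennreal_ofReal h
  · rw [apExpr, if_neg hp.ne', mul_comm]
    exact lintegral_rpow_neg_rpow_mul_le hp hw.ennreal_ofReal h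

end Testing

section Products

variable {α β : Type*} [MeasureSpace α] [MeasureSpace β] {p : ℝ} {C D : ℝ≥0∞}

lemma laverage_const_mul {μ : Measure α} {f : α → ℝ≥0∞}
    (hf : Measurable f) (c : ℝ≥0∞) : ⨍⁻ x, c * f x ∂μ = c * ⨍⁻ x, f x ∂μ :=
  lintegral_const_mul c hf

lemma setLAverage_prod [SFinite (volume : Measure α)] [SFinite (volume : Measure β)] {S : Set α}
    {T : Set β} (hS : volume S ≠ ∞) (hT : volume T ≠ ∞) {f : α × β → ℝ≥0∞} (hf : Measurable f) :
    ⨍⁻ z in S ×ˢ T, f z ∂volume = ⨍⁻ y in T, ⨍⁻ x in S, f (x, y) ∂volume ∂volume := by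
  have hinner : Measurable fun y => ∫⁻ x in S, f (x, y) := hf.lintegral_prod_left'
  simp only [setLAverage_eq, div_eq_mul_inv]
  rw [lintegral_mul_const _ hinner, Measure.volume_eq_prod, Measure.prod_prod,
    ← Measure.prod_restrict, lintegral_prod_symm f hf.aemeasurable,
    ENNReal.mul_inv (.inr hT) (.inl hS), mul_assoc]

lemma TestingCondition.prod [SFinite (volume : Measure α)] [SFinite (volume : Measure β)]
    {W : α × β → ℝ≥0∞} (hW : Measurable W) {S : Set α} {T : Set β}
    (hS : volume S ≠ ∞) (hT : volume T ≠ ∞)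
    (hfst : ∀ᵐ y, TestingCondition p C (fun x => W (x, y)) S)
    (hsnd : TestingCondition p D (fun y => ⨍⁻ x in S, W (x, y) ∂volume) T) :
    TestingCondition p (C * D) W (S ×ˢ T) := by
  intro f hf
  have hfW : Measurable fun z => f z ^ p * W z := (hf.pow_const p).mul hW
  have hmeas {F : α × β → ℝ≥0∞} (hF : Measurable F) :
      Measurable fun y => ⨍⁻ x in S, F (x, y) ∂volume := hF.lintegral_prod_left'
  rw [setLAverage_prod hS hT hf, setLAverage_prod hS hT hW, setLAverage_prod hS hT hfW]
  calc _ ≤ D * ⨍⁻ y in T, (⨍⁻ x in S, f (x, y) ∂volume) ^ p *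
        (⨍⁻ x in S, W (x, y) ∂volume) ∂volume := hsnd _ (hmeas hf)
    _ ≤ D * ⨍⁻ y in T, C * (⨍⁻ x in S, f (x, y) ^ p * W (x, y) ∂volume) ∂volume := by
      gcongr D * ?_
      refine setLAverage_mono_ae _ ?_
      filter_upwards [hfst] with y hy
      exact hy _ (hf.comp measurable_prodMk_right)
    _ = _ := by
      rw [laverage_const_mul (hmeas hfW), ← mul_assoc, mul_comm D C]

lemma TestingCondition.laverage [SFinite (volume : Measure α)] [SFinite (volume : Measure β)]
    {V : α × β → ℝ≥0∞} (hV : Measurable V) {S : Set α} {T : Set β}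
    (h : ∀ᵐ x, TestingCondition p C (fun y => V (x, y)) T) :
    TestingCondition p C (fun y => ⨍⁻ x in S, V (x, y) ∂volume) T := by
  intro f hf
  have swap {F : α × β → ℝ≥0∞} (hF : Measurable F) :
      ⨍⁻ y in T, ⨍⁻ x in S, F (x, y) ∂volume ∂volume =
        ⨍⁻ x in S, ⨍⁻ y in T, F (x, y) ∂volume ∂volume :=
    lintegral_lintegral_swap (hF.comp measurable_swap).aemeasurable
  have hfV : Measurable fun z : α × β => f z.2 ^ p * V z :=
    ((hf.comp measurable_snd).pow_const p).mul hV
  have hmeas {F : α × β → ℝ≥0∞} (hF : Measurable F) :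
      Measurable fun x => ⨍⁻ y in T, F (x, y) ∂volume := hF.lintegral_prod_right'
  have pull (y : β) : ⨍⁻ x in S, f y ^ p * V (x, y) ∂volume =
      f y ^ p * ⨍⁻ x in S, V (x, y) ∂volume :=
    laverage_const_mul (hV.comp measurable_prodMk_right) _
  calc _ = ⨍⁻ x in S, (⨍⁻ y in T, f y ∂volume) ^ p *
        (⨍⁻ y in T, V (x, y) ∂volume) ∂volume := by
        rw [swap hV, laverage_const_mul (hmeas hV)]
    _ ≤ ⨍⁻ x in S, C * (⨍⁻ y in T, f y ^ p * V (x, y) ∂volume) ∂volume := by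
      refine setLAverage_mono_ae _ ?_
      filter_upwards [h] with x hx
      exact hx f hf
    _ = C * ⨍⁻ y in T, ⨍⁻ x in S, f y ^ p * V (x, y) ∂volume ∂volume := by
      rw [laverage_const_mul (hmeas hfV), ← swap hfV]
    _ = _ := by simp only [pull]

lemma TestingCondition.of_comp {e : α → β} (he : MeasurePreserving e volume volume)
    {W : β → ℝ≥0∞} (hW : Measurable W) {Q : Set β} (hQ : MeasurableSet Q)
    (h : TestingCondition p C (fun x => W (e x)) (e ⁻¹' Q)) : TestingCondition p C W Q := by
  intro f hf
  have comp {F : β → ℝ≥0∞} (hF : Measurable F) :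
      ⨍⁻ x in e ⁻¹' Q, F (e x) ∂volume = ⨍⁻ y in Q, F y ∂volume := by
    rw [setLAverage_eq, setLAverage_eq, he.setLIntegral_comp_preimage hQ hF,
      he.measure_preimage hQ.nullMeasurableSet]
  have hfW : Measurable fun y => f y ^ p * W y := (hf.pow_const p).mul hW
  rw [← comp hf, ← comp hW, ← comp hfW]
  exact h _ (hf.comp he.measurable)

end Products

section Slices

variable {d : ℕ}

lemma measurePreserving_insertNth (j : Fin (d + 1)) :
    MeasurePreserving fun z : ℝ × (Fin d → ℝ) => (j.insertNth z.1 z.2 : Fin (d + 1) → ℝ) :=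
  (volume_preserving_piFinSuccAbove (fun _ => ℝ) j).symm

lemma quasiMeasurePreserving_removeNth (j : Fin (d + 1)) :
    Measure.QuasiMeasurePreserving fun y : Fin (d + 1) → ℝ => j.removeNth y :=
  Measure.quasiMeasurePreserving_snd.comp
    (volume_preserving_piFinSuccAbove (fun _ => ℝ) j).quasiMeasurePreserving

lemma ae_ae_insertNth (j : Fin (d + 1)) {P : (Fin (d + 1) → ℝ) → Prop} (h : ∀ᵐ y, P y) :
    ∀ᵐ x : Fin d → ℝ, ∀ᵐ t : ℝ, P (j.insertNth t x) :=
  Measure.ae_ae_of_ae_prod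
    (((measurePreserving_insertNth j).comp Measure.measurePreserving_swap).quasiMeasurePreserving.ae
      h)

lemma ae_slice_congr {w w' : (Fin (d + 1) → ℝ) → ℝ} (h : w =ᵐ[volume] w') (j : Fin (d + 1)) :
    ∀ᵐ x : Fin d → ℝ, slice w j x =ᵐ[volume] slice w' j x :=
  ae_ae_insertNth j h

lemma strongApConst_congr_ae (p : ℝ) {w w' : (Fin (d + 1) → ℝ) → ℝ} (h : w =ᵐ[volume] w') :
    strongApConst p w = strongApConst p w' :=
  iSup_congr fun j => essSup_congr_ae <| (ae_slice_congr h j).mono fun _ => apConst_congr_ae p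

lemma recApConst_congr_ae {n : ℕ} (p : ℝ) {w w' : (Fin n → ℝ) → ℝ} (h : w =ᵐ[volume] w') :
    recApConst p w = recApConst p w' := by
  simp only [recApConst, apExpr_congr_ae p (ae_restrict_of_ae h)]

lemma ae_locallyIntegrable_slice {w : (Fin (d + 1) → ℝ) → ℝ}
    (hw : LocallyIntegrable w volume) (j : Fin (d + 1)) :
    ∀ᵐ x : Fin d → ℝ, LocallyIntegrable (slice w j x) volume := by
  have hball (k : ℕ) : ∀ᵐ x : Fin d → ℝ, Integrable fun t : ℝ =>
      (Metric.closedBall 0 (k : ℝ)).indicator w (j.insertNth t x) := by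
    have hint : Integrable ((Metric.closedBall 0 (k : ℝ)).indicator w) :=
      (hw.integrableOn_isCompact (isCompact_closedBall 0 (k : ℝ))).integrable_indicator
        measurableSet_closedBall
    exact ((measurePreserving_insertNth j).integrable_comp_of_integrable hint).prod_left_ae
  filter_upwards [ae_all_iff.2 hball] with x hx t
  obtain ⟨k, hk⟩ := exists_nat_gt (max ‖x‖ ‖t‖)
  have hmem {s : ℝ} (hs : s ∈ Metric.ball (0 : ℝ) k) :
      (j.insertNth s x : Fin (d + 1) → ℝ) ∈ Metric.closedBall 0 (k : ℝ) := by
    rw [mem_closedBall_zero_iff, pi_norm_le_iff_of_nonneg k.cast_nonneg, j.forall_iff_succAbove]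
    simp only [Fin.insertNth_apply_same, Fin.insertNth_apply_succAbove]
    exact ⟨(mem_ball_zero_iff.1 hs).le,
      fun i => (norm_le_pi_norm x i).trans ((le_max_left _ _).trans hk.le)⟩
  refine ⟨Metric.ball 0 k, Metric.isOpen_ball.mem_nhds
    (mem_ball_zero_iff.2 ((le_max_right _ _).trans_lt hk)), ?_⟩
  exact (hx k).integrableOn.congr_fun (fun s hs => indicator_of_mem (hmem hs) w)
    Metric.isOpen_ball.measurableSet

end Slices

section Boxes

variable {n d : ℕ} {p : ℝ} {C : ℝ≥0∞}

/-- Almost every restriction of `W` to a line parallel to a coordinate axis satisfies the testing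
condition on all bounded intervals. The lines are indexed by one of their points rather than by the
`n - 1` frozen coordinates, which makes sense for `n = 0` as well. -/
def LineTesting (p : ℝ) (C : ℝ≥0∞) (W : (Fin n → ℝ) → ℝ≥0∞) : Prop :=
  ∀ j, ∀ᵐ x : Fin n → ℝ, ∀ a b, a < b →
    TestingCondition p C (fun t => W (Function.update x j t)) (Icc a b)

lemma LineTesting.ae_cons {W : (Fin (n + 1) → ℝ) → ℝ≥0∞} (h : LineTesting p C W) {a b : ℝ}
    (hab : a < b) :
    ∀ᵐ x : Fin n → ℝ, TestingCondition p C (fun t => W (Fin.cons t x)) (Icc a b) := by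
  filter_upwards [ae_ae_insertNth 0 (h 0)] with x hx
  obtain ⟨s, hs⟩ := hx.exists
  simpa only [Fin.insertNth_zero', Fin.update_cons_zero] using hs a b hab

lemma LineTesting.laverage_cons {W : (Fin (n + 1) → ℝ) → ℝ≥0∞} (hW : Measurable W)
    (h : LineTesting p C W) (S : Set ℝ) :
    LineTesting p C fun x : Fin n → ℝ => ⨍⁻ t in S, W (Fin.cons t x) ∂volume := by
  intro j
  filter_upwards [ae_ae_insertNth 0 (h j.succ)] with x hx a b hab
  simp only [Fin.insertNth_zero', ← Fin.cons_update] at hx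
  have hmeas : Measurable fun z : ℝ × ℝ =>
      W (Fin.cons z.1 (Function.update x j z.2)) := by
    refine hW.comp (measurable_pi_iff.2 (Fin.cases measurable_fst fun i => ?_))
    exact (measurable_pi_apply i).comp ((measurable_update x).comp measurable_snd)
  exact TestingCondition.laverage hmeas (hx.mono fun t ht => ht a b hab)

lemma preimage_insertNth_zero_Icc (a b : Fin (n + 1) → ℝ) :
    (fun z : ℝ × (Fin n → ℝ) => ((0 : Fin (n + 1)).insertNth z.1 z.2 : Fin (n + 1) → ℝ)) ⁻¹'
      Icc a b = Icc (a 0) (b 0) ×ˢ Icc (Fin.tail a) (Fin.tail b) := by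
  ext z
  simp only [mem_preimage, mem_prod, mem_Icc, Pi.le_def, Fin.forall_fin_succ,
    Fin.insertNth_zero', Fin.cons_zero, Fin.cons_succ, Fin.tail]
  tauto

theorem LineTesting.testingCondition_Icc {W : (Fin n → ℝ) → ℝ≥0∞} (hW : Measurable W)
    (h : LineTesting p C W) {a b : Fin n → ℝ} (hab : ∀ i, a i < b i) :
    TestingCondition p (C ^ n) W (Icc a b) := by
  induction n with
  | zero =>
    intro f _
    have hIcc : Icc a b = univ :=
      eq_univ_of_forall fun _ => ⟨(Subsingleton.elim _ _).le, (Subsingleton.elim _ _).le⟩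
    simp [hIcc, Measure.volume_pi_eq_dirac 0, laverage_eq]
  | succ n ih =>
    have he := measurePreserving_insertNth (0 : Fin (n + 1))
    have hmeas := hW.comp he.measurable
    refine TestingCondition.of_comp he hW measurableSet_Icc ?_
    rw [preimage_insertNth_zero_Icc, pow_succ']
    refine TestingCondition.prod hmeas measure_Icc_lt_top.ne measure_Icc_lt_top.ne ?_ ?_
    · simpa only [Function.comp_apply, Fin.insertNth_zero'] using h.ae_cons (hab 0)
    · refine ih ?_ ?_ fun i => hab i.succ
      · exact hmeas.lintegral_prod_left'
      · simpa only [Function.comp_apply, Fin.insertNth_zero'] using h.laverage_cons hW _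

lemma lineTesting_of_strongApConst_le {w : (Fin (d + 1) → ℝ) → ℝ} (hw : Measurable w) (hp : 1 ≤ p)
    (hC : C ≠ ∞) (h : strongApConst p w ≤ C) :
    LineTesting p C fun x => ENNReal.ofReal (w x) := by
  intro j
  have hslice : ∀ᵐ x : Fin d → ℝ, apConst p (slice w j x) ≤ C := by
    filter_upwards [ENNReal.ae_le_essSup fun x : Fin d → ℝ => apConst p (slice w j x)] with x hx
    exact hx.trans ((le_iSup _ j).trans h)
  filter_upwards [(quasiMeasurePreserving_removeNth j).ae hslice] with y hy a b hab
  have hmeas : Measurable (slice w j (j.removeNth y)) :=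
    hw.comp ((measurePreserving_insertNth j).measurable.comp measurable_prodMk_right)
  have hI : apExpr p (slice w j (j.removeNth y)) (Icc a b) ≤ C :=
    (iSup_le_iff.1 (iSup₂_le_iff.1 hy a b)) hab
  simpa only [slice, Fin.insertNth_removeNth] using
    testingCondition_of_apExpr_le hmeas.aemeasurable hp hC hI

lemma volume_Icc_pi_ne_zero {a b : Fin n → ℝ} (hab : ∀ i, a i < b i) :
    volume (Icc a b) ≠ 0 := by
  simpa [Real.volume_Icc_pi, Finset.prod_eq_zero_iff] using hab

theorem recApConst_le_pow {w : (Fin (d + 1) → ℝ) → ℝ} (hw : AEMeasurable w) (hp : 1 ≤ p)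
    (hC : C ≠ ∞) (h : strongApConst p w ≤ C) : recApConst p w ≤ C ^ (d + 1) := by
  rw [strongApConst_congr_ae p hw.ae_eq_mk] at h
  rw [recApConst_congr_ae p hw.ae_eq_mk]
  have hline := lineTesting_of_strongApConst_le hw.measurable_mk hp hC h
  exact iSup₂_le fun a b => iSup_le fun hab =>
    (hline.testingCondition_Icc hw.measurable_mk.ennreal_ofReal hab).apExpr_le hw.measurable_mk hp
      (volume_Icc_pi_ne_zero hab) measure_Icc_lt_top.ne

theorem strongApConst_le_exp {w : (Fin (d + 1) → ℝ) → ℝ} (hw : LocallyIntegrable w volume) {A : ℝ}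
    (hA : strongAInftyConst w ≤ ENNReal.ofReal A) (hp : Real.exp (15 * A) ≤ p) :
    strongApConst p w ≤ ENNReal.ofReal (Real.exp (15 * A * p)) := by
  refine iSup_le fun j => essSup_le_of_ae_le _ ?_
  filter_upwards [ae_locallyIntegrable_slice hw j,
    ENNReal.ae_le_essSup fun x : Fin d → ℝ => aInftyConst (slice w j x)] with x hx hxA
  exact apConst_le_exp hx (hxA.trans ((le_iSup _ j).trans hA)) hp

end Boxes

end StrongWeights

theorem mainTheorem4 :
    ∃ c : ℝ, 0 < c ∧
      ∀ (d : ℕ) (w : (Fin (d + 1) → ℝ) → ℝ), StrongWeights.MemStrongAInfty w →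
        ∀ p : ℝ, Real.exp (c * (StrongWeights.strongAInftyConst w).toReal) ≤ p →
          StrongWeights.MemStrongAp p w ∧
          StrongWeights.strongApConst p w ≤
            ENNReal.ofReal
              (Real.exp (Real.exp (c * p * (StrongWeights.strongAInftyConst w).toReal))) := by
  refine ⟨15, by norm_num, fun d w ⟨hw, hA⟩ p hp => ?_⟩
  set A := (StrongWeights.strongAInftyConst w).toReal
  have hp1 : 1 ≤ p := (Real.one_le_exp (by positivity)).trans hp
  have hslices : StrongWeights.strongApConst p w ≤ ENNReal.ofReal (Real.exp (15 * A * p)) :=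
    StrongWeights.strongApConst_le_exp hw.2 (ENNReal.ofReal_toReal hA.ne).ge hp
  have hboxes : StrongWeights.recApConst p w ≤ ENNReal.ofReal (Real.exp (15 * A * p)) ^ (d + 1) :=
    StrongWeights.recApConst_le_pow hw.2.aestronglyMeasurable.aemeasurable hp1
      ENNReal.ofReal_ne_top hslices
  refine ⟨⟨hw, hboxes.trans_lt (ENNReal.pow_lt_top ENNReal.ofReal_lt_top)⟩, hslices.trans ?_⟩
  gcongr
  linarith [Real.add_one_le_exp (15 * p * A)]
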